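/- Let $H$ be a complex Hilbert space (inner products linear in the second variable, $|x\rangle\langle y|(z)=\langle y,z\rangle x$). Let $L$, with domain $D(L)$, be the ($\sigma$-weak) generator of a quantum Markov semigroup $(T_t)_{t\ge 0}$ on $\mathcal B(H)$, i.e. of a one-parameter semigroup of $\sigma$-weakly continuous, completely positive, unital linear maps on $\mathcal B(H)$ with $T_0=\mathrm{id}$ and $\sigma$-weakly continuous orbits $t\mapsto T_t(A)$. Let $\mathcal A$ be the domain algebra of $L$, the largest $*$-subalgebra of $\mathcal B(H)$ contained in $D(L)$. Let $T\in D(L)$ be a nonzero positive finite rank operator and let $h$ be an associate vector for $T$; that is, there is a decomposition $T=\sum_{s=1}^m t'_s|k'_s\rangle\langle k'_s|$ with $(k'_s)$ orthonormal and $t'_s>0$ such that, with $t=\sum_s t'_s$ and $k_s=\sqrt t\,k'_s$, one has $h=\sum_s\|k_s\|^{-2}k_s$. Assume that $|Th\rangle\langle Th|\in D(L)$, put $U=\{x\in H: |x\rangle\langle Th|\in\mathcal A\}$, and assume that $U$ is norm dense in $H$ and that there is $C>0$ with $\|L(|x\rangle\langle Th|)h\|\le C\|x\|$ for all $x\in U$.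 By a minimal Stinespring-type dilation we mean a Hilbert space $K$, bounded operators $G:H\to H$ and $V:H\to K$, and a norm-continuous unital $*$-representation $\pi:\mathcal A\to\mathcal B(K)$, such that $$L(A)=V^*\pi(A)V+GA+AG^*\qquad(A\in\mathcal A)$$ and $\{\pi(A)Vx: A\in\mathcal A,\ x\in U\}$ is total in $K$. Then a minimal Stinespring-type dilation exists, and it can be chosen with $Gx=L(|x\rangle\langle Th|)h-\tfrac12\langle h,L(T)h\rangle x$ for all $x\in U$. Moreover, for every minimal Stinespring-type dilation, the representation $\pi$ is ($\sigma$-weak, $\sigma$-weak)-closable: whenever $(A_\lambda)$ is a net in $\mathcal A$ with $A_\lambda\to0$ $\sigma$-weakly and $\pi(A_\lambda)\to B$ $\sigma$-weakly for some $B\in\mathcal B(K)$, then $B=0$. -/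

import Mathlib

open Filter Topology
open scoped NNReal InnerProductSpace CStarAlgebra

universe u v

noncomputable section

/-- The σ-weak topology on the bounded operators of a Hilbert space: the coarsest topology that
makes continuous all functionals `A ↦ ∑ₙ ⟪xₙ, A yₙ⟫` with `∑ₙ ‖xₙ‖² < ∞` and `∑ₙ ‖yₙ‖² < ∞`. These
functionals are exactly those given by the trace class operators `∑ₙ |yₙ⟩⟨xₙ|`. -/
@[reducible]
def sigmaWeak (H : Type*) [NormedAddCommGroup H] [InnerProductSpace ℂ H] :
    TopologicalSpace (H →L[ℂ] H) :=
  ⨅ (x : ℕ → H) (y : ℕ → H) (_ : Summable fun n => ‖x n‖ ^ 2) (_ : Summable fun n => ‖y n‖ ^ 2),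
    TopologicalSpace.induced (fun A : H →L[ℂ] H => ∑' n, ⟪x n, A (y n)⟫_ℂ) inferInstance

/-- σ-weak convergence of an operator-valued function `f` to `B` along a filter. -/
def SigmaWeakTendsto {ι H : Type*} [NormedAddCommGroup H] [InnerProductSpace ℂ H]
    (f : ι → H →L[ℂ] H) (l : Filter ι) (B : H →L[ℂ] H) : Prop :=
  Tendsto f l (@nhds (H →L[ℂ] H) (sigmaWeak H) B)

/-- A quantum Markov semigroup on `B(H)`: a one-parameter semigroup of σ-weakly continuous,
completely positive, unital linear maps with σ-weakly continuous orbits. -/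
structure QuantumMarkovSemigroup (H : Type u) [NormedAddCommGroup H] [InnerProductSpace ℂ H]
    [CompleteSpace H] where
  toFun : ℝ≥0 → ((H →L[ℂ] H) →CP (H →L[ℂ] H))
  sigmaWeak_continuous : ∀ t, Continuous[sigmaWeak H, sigmaWeak H] (toFun t)
  map_zero : ∀ A, toFun 0 A = A
  map_add : ∀ t s A, toFun (t + s) A = toFun t (toFun s A)
  orbit_continuous : ∀ A, Continuous[inferInstance, sigmaWeak H] fun t => toFun t A
  map_one : ∀ t, toFun t 1 = 1

namespace QuantumMarkovSemigroup

variable {H : Type u} [NormedAddCommGroup H] [InnerProductSpace ℂ H] [CompleteSpace H]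

/-- `B` is the σ-weak limit of `t⁻¹ (T_t A - A)` as `t → 0`, `t > 0`. -/
def IsDerivAtZero (S : QuantumMarkovSemigroup H) (A B : H →L[ℂ] H) : Prop :=
  SigmaWeakTendsto (fun t : ℝ≥0 => ((t : ℝ) : ℂ)⁻¹ • (S.toFun t A - A)) (𝓝[>] 0) B

/-- The domain `D(L)` of the infinitesimal generator. -/
def domain (S : QuantumMarkovSemigroup H) : Set (H →L[ℂ] H) :=
  {A | ∃ B, S.IsDerivAtZero A B}

open Classical in
/-- The infinitesimal generator `L`; it is given the value `0` off its domain. -/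
def generator (S : QuantumMarkovSemigroup H) (A : H →L[ℂ] H) : H →L[ℂ] H :=
  if hA : ∃ B, S.IsDerivAtZero A B then hA.choose else 0

/-- The domain algebra of `L`: the largest `*`-subalgebra of `B(H)` contained in `D(L)`, that is,
the supremum of all of them. Since `1 ∈ D(L)`, only unital ones have to be considered. -/
def domainAlgebra (S : QuantumMarkovSemigroup H) : StarSubalgebra ℂ (H →L[ℂ] H) :=
  sSup {M | (M : Set (H →L[ℂ] H)) ⊆ S.domain}

/-- The set `{x ∈ H : |x⟩⟨y| ∈ 𝒜}`, where `𝒜` is the domain algebra. -/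
def rankOneSpace (S : QuantumMarkovSemigroup H) (y : H) : Set H :=
  {x | InnerProductSpace.rankOne ℂ x y ∈ S.domainAlgebra}

/-- `L(A) = V* π(A) V + G A + A G*` on the domain algebra, with `π` a norm-continuous unital
`*`-representation of the domain algebra on a Hilbert space `K`, and with the vectors `π(A) V u`
(`A` in the domain algebra, `u ∈ U`) total in `K`. -/
structure IsMinimalStinespring (S : QuantumMarkovSemigroup H) (U : Set H)
    {K : Type v} [NormedAddCommGroup K] [InnerProductSpace ℂ K] [CompleteSpace K]
    (G : H →L[ℂ] H) (V : H →L[ℂ] K) (π : S.domainAlgebra →⋆ₐ[ℂ] (K →L[ℂ] K)) : Prop where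
  norm_continuous : Continuous π
  generator_eq : ∀ A : S.domainAlgebra,
    S.generator A = V.adjoint ∘L π A ∘L V + G ∘L (A : H →L[ℂ] H) + (A : H →L[ℂ] H) ∘L G.adjoint
  minimal : Dense (Submodule.span ℂ {w : K | ∃ A : S.domainAlgebra, ∃ x ∈ U, w = π A (V x)} : Set K)

end QuantumMarkovSemigroup

/-- `h` is an associate vector of the positive finite rank operator `T`: for a spectral decomposition
`T = ∑ₛ t'ₛ |k'ₛ⟩⟨k'ₛ|` with `k'` orthonormal and all `t'ₛ > 0`, put `t = ∑ₛ t'ₛ` and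
`kₛ = √t k'ₛ`; then `h = ∑ₛ ‖kₛ‖⁻² kₛ`. -/
def IsAssociateVector {H : Type*} [NormedAddCommGroup H] [InnerProductSpace ℂ H]
    (T : H →L[ℂ] H) (h : H) : Prop :=
  ∃ (m : ℕ) (k' : Fin m → H) (t' : Fin m → ℝ) (k : Fin m → H),
    Orthonormal ℂ k' ∧ (∀ s, 0 < t' s) ∧
    T = ∑ s, (t' s : ℂ) • InnerProductSpace.rankOne ℂ (k' s) (k' s) ∧
    (∀ s, k s = (Real.sqrt (∑ r, t' r) : ℂ) • k' s) ∧
    h = ∑ s, ((‖k s‖ ^ 2)⁻¹ : ℂ) • k s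

/-- A map `f` from a `*`-subalgebra `M` of `B(H)` to `B(K)` is (σ-weak, σ-weak)-closable: whenever a
net in `M` tends σ-weakly to `0` and its image under `f` tends σ-weakly to `B`, then `B = 0`. Nets
are expressed by nontrivial filters. -/
def IsSigmaWeaklyClosable {H K : Type*} [NormedAddCommGroup H] [InnerProductSpace ℂ H]
    [CompleteSpace H] [NormedAddCommGroup K] [InnerProductSpace ℂ K]
    (M : StarSubalgebra ℂ (H →L[ℂ] H)) (f : M → K →L[ℂ] K) : Prop :=
  ∀ (l : Filter M) [l.NeBot] (B : K →L[ℂ] K),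
    SigmaWeakTendsto (fun A : M => (A : H →L[ℂ] H)) l 0 → SigmaWeakTendsto f l B → B = 0

end

/-! The engine is conditional complete positivity of `L`: the double sum of `⟪xᵢ, L(bᵢ* bⱼ) xⱼ⟫` has
nonnegative real part whenever `∑ bᵢ xᵢ = 0`, because the zeroth-order term of the difference
quotient then vanishes. For arbitrary `bᵢ` and `xᵢ ∈ U` the constraint is restored by adjoining the
pair `(-|z⟩⟨Th|, h)` with `z = ∑ bᵢ xᵢ`, since `⟨Th, h⟩ = 1`. The cross terms are then `L(|bᵢ*
z⟩⟨Th|)h`, which is `G(bᵢ* z)` up to a multiple of `bᵢ* z`. The new diagonal term is at most `‖z‖²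
⟨h, L(T)h⟩`, because `T - |Th⟩⟨Th|` is positive and kills `h`; the summand `-½⟨h, L(T)h⟩` in `G`
absorbs it. So `A ↦ L(A) - GA - AG*` satisfies Stinespring's positivity condition
(`re_sum_inner_dissipation_nonneg`), and `exists_stinespring` yields `π` and `V`.

For closability, let `A_λ → 0` and `π(A_λ) → B`. Then `L(C* A_λ D) → V* π(C)* B π(D) V`, so it
suffices that `L` itself is σ-weakly closable. This follows from `T_t A - A = ∫₀ᵗ T_s L(A) ds`, once
the functionals `X ↦ ∫₀ᵗ ⟨x, T_s X x⟩ ds` are known to be normal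
(`exists_integralFunctional_eq_tsum`).

The domain algebra is a supremum of `*`-subalgebras, so its inclusion in `D(L)` needs proof. All
those subalgebras lie in one `*`-algebra inside `D(L)`, `linearDefectAlgebra`, cut out by `T_t(A*A)
- T_t(A)* T_t(A) = O(t)` for `A` and `A*`. -/

section SigmaWeak

/-! ### σ-weak convergence of operators. -/

variable {H : Type*} [NormedAddCommGroup H] [InnerProductSpace ℂ H]

theorem sigmaWeakTendsto_iff {ι : Type*} {f : ι → H →L[ℂ] H} {l : Filter ι} {B : H →L[ℂ] H} :
    SigmaWeakTendsto f l B ↔ ∀ x y : ℕ → H, (Summable fun n => ‖x n‖ ^ 2) →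
      (Summable fun n => ‖y n‖ ^ 2) →
      Tendsto (fun i => ∑' n, ⟪x n, f i (y n)⟫_ℂ) l (𝓝 (∑' n, ⟪x n, B (y n)⟫_ℂ)) := by
  simp only [SigmaWeakTendsto, nhds_iInf, nhds_induced, tendsto_iInf, tendsto_comap_iff,
    Function.comp_def]

theorem SigmaWeakTendsto.inner {ι : Type*} {f : ι → H →L[ℂ] H} {l : Filter ι} {B : H →L[ℂ] H}
    (hf : SigmaWeakTendsto f l B) (x y : H) :
    Tendsto (fun i => ⟪x, f i y⟫_ℂ) l (𝓝 ⟪x, B y⟫_ℂ) := by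
  have hs : ∀ z : H, Summable fun n : ℕ => ‖(if n = 0 then z else 0 : H)‖ ^ 2 := fun z =>
    summable_of_ne_finset_zero (s := {0}) fun n hn => by
      simp only [Finset.mem_singleton] at hn
      simp [hn]
  have h := sigmaWeakTendsto_iff.1 hf (fun n => if n = 0 then x else 0)
    (fun n => if n = 0 then y else 0) (hs x) (hs y)
  have key : ∀ A : H →L[ℂ] H, ∑' n : ℕ, ⟪(if n = 0 then x else 0 : H),
      A (if n = 0 then y else 0 : H)⟫_ℂ = ⟪x, A y⟫_ℂ := fun A => by
    rw [tsum_eq_single 0 (fun n hn => by simp [hn])]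
    simp
  simpa only [key] using h

theorem ext_inner_self {A B : H →L[ℂ] H} (h : ∀ x, ⟪x, A x⟫_ℂ = ⟪x, B x⟫_ℂ) : A = B := by
  have := (ext_inner_map (A : H →ₗ[ℂ] H) (B : H →ₗ[ℂ] H)).1 fun x => by
    rw [← inner_conj_symm, ← inner_conj_symm (((B : H →ₗ[ℂ] H)) x)]
    exact congrArg _ (h x)
  exact ContinuousLinearMap.coe_injective this

theorem tendsto_inner_of_tendsto_inner_self {ι : Type*} {f : ι → H →L[ℂ] H} {l : Filter ι}
    {B : H →L[ℂ] H} (hf : ∀ x, Tendsto (fun i => ⟪x, f i x⟫_ℂ) l (𝓝 ⟪x, B x⟫_ℂ)) (x y : H) :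
    Tendsto (fun i => ⟪x, f i y⟫_ℂ) l (𝓝 ⟪x, B y⟫_ℂ) := by
  have key : ∀ A : H →L[ℂ] H, ⟪x, A y⟫_ℂ = (⟪y + x, A (y + x)⟫_ℂ - ⟪y - x, A (y - x)⟫_ℂ
      + Complex.I * ⟪y + Complex.I • x, A (y + Complex.I • x)⟫_ℂ
      - Complex.I * ⟪y - Complex.I • x, A (y - Complex.I • x)⟫_ℂ) / 4 := fun A => by
    simp only [map_add, map_sub, map_smul, inner_add_left, inner_add_right, inner_sub_left,
      inner_sub_right, inner_smul_left, inner_smul_right, Complex.conj_I]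
    ring_nf
    simp only [Complex.I_sq]
    ring
  simp only [key]
  exact ((((hf _).sub (hf _)).add ((hf _).const_mul _)).sub ((hf _).const_mul _)).div_const _

/-- On bounded sets weak and σ-weak convergence agree: the defining series are dominated termwise,
and polarization reduces matrix elements to diagonal ones. -/
theorem sigmaWeakTendsto_of_bounded {ι : Type*} {f : ι → H →L[ℂ] H} {l : Filter ι}
    {B : H →L[ℂ] H} {C : ℝ} (hC : ∀ᶠ i in l, ‖f i‖ ≤ C)
    (hf : ∀ x, Tendsto (fun i => ⟪x, f i x⟫_ℂ) l (𝓝 ⟪x, B x⟫_ℂ)) : SigmaWeakTendsto f l B := by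
  rw [sigmaWeakTendsto_iff]
  intro x y hx hy
  refine tendsto_tsum_of_dominated_convergence (bound := fun n => C * (‖x n‖ ^ 2 + ‖y n‖ ^ 2))
    ((hx.add hy).mul_left C) (fun n => tendsto_inner_of_tendsto_inner_self hf _ _) ?_
  filter_upwards [hC] with i hi n
  have hC0 : 0 ≤ C := (norm_nonneg _).trans hi
  calc ‖⟪x n, f i (y n)⟫_ℂ‖ ≤ ‖x n‖ * ‖f i (y n)‖ := norm_inner_le_norm _ _
    _ ≤ ‖x n‖ * (C * ‖y n‖) := by
        gcongr
        exact (f i).le_of_opNorm_le hi _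
    _ ≤ C * (‖x n‖ ^ 2 + ‖y n‖ ^ 2) := by
        have : ‖x n‖ * ‖y n‖ ≤ ‖x n‖ ^ 2 + ‖y n‖ ^ 2 := by
          nlinarith [sq_nonneg (‖x n‖ - ‖y n‖), sq_nonneg (‖x n‖), sq_nonneg (‖y n‖)]
        calc _ = C * (‖x n‖ * ‖y n‖) := by ring
          _ ≤ _ := by gcongr

theorem SigmaWeakTendsto.unique {ι : Type*} {f : ι → H →L[ℂ] H} {l : Filter ι} [l.NeBot]
    {B B' : H →L[ℂ] H} (h : SigmaWeakTendsto f l B) (h' : SigmaWeakTendsto f l B') : B = B' :=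
  ext_inner_self fun x => tendsto_nhds_unique (h.inner x x) (h'.inner x x)

theorem SigmaWeakTendsto.add {ι : Type*} {f g : ι → H →L[ℂ] H} {l : Filter ι}
    {A B : H →L[ℂ] H} (hf : SigmaWeakTendsto f l A) (hg : SigmaWeakTendsto g l B) :
    SigmaWeakTendsto (fun i => f i + g i) l (A + B) := by
  rw [sigmaWeakTendsto_iff] at *
  intro x y hx hy
  have hs : ∀ A : H →L[ℂ] H, Summable fun n => ⟪x n, A (y n)⟫_ℂ := fun A => by
    refine Summable.of_norm_bounded (g := fun n => ‖A‖ * (‖x n‖ ^ 2 + ‖y n‖ ^ 2))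
      ((hx.add hy).mul_left _) fun n => ?_
    calc ‖⟪x n, A (y n)⟫_ℂ‖ ≤ ‖x n‖ * ‖A (y n)‖ := norm_inner_le_norm _ _
      _ ≤ ‖x n‖ * (‖A‖ * ‖y n‖) := by
          gcongr
          exact A.le_opNorm _
      _ = ‖A‖ * (‖x n‖ * ‖y n‖) := by ring
      _ ≤ _ := by
          gcongr
          nlinarith [sq_nonneg (‖x n‖ - ‖y n‖), sq_nonneg (‖x n‖), sq_nonneg (‖y n‖)]
  simpa only [_root_.add_apply, inner_add_right, (hs _).tsum_add (hs _)] using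
    (hf x y hx hy).add (hg x y hx hy)

theorem Summable.norm_sq_map {K : Type*} [NormedAddCommGroup K] [InnerProductSpace ℂ K]
    (A : H →L[ℂ] K) {x : ℕ → H} (hx : Summable fun n => ‖x n‖ ^ 2) :
    Summable fun n => ‖A (x n)‖ ^ 2 := by
  refine Summable.of_nonneg_of_le (fun n => sq_nonneg _) (fun n => ?_) (hx.mul_left (‖A‖ ^ 2))
  rw [← mul_pow]
  gcongr
  exact A.le_opNorm _

variable [CompleteSpace H]

theorem SigmaWeakTendsto.sandwich {ι K : Type*} [NormedAddCommGroup K] [InnerProductSpace ℂ K]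
    [CompleteSpace K] {f : ι → K →L[ℂ] K} {l : Filter ι} {B : K →L[ℂ] K}
    (hf : SigmaWeakTendsto f l B) (V : K →L[ℂ] H) (W : H →L[ℂ] K) :
    SigmaWeakTendsto (fun i => V ∘L f i ∘L W) l (V ∘L B ∘L W) := by
  rw [sigmaWeakTendsto_iff] at *
  intro x y hx hy
  simpa [ContinuousLinearMap.adjoint_inner_left] using
    hf (fun n => V.adjoint (x n)) (fun n => W (y n)) (hx.norm_sq_map V.adjoint) (hy.norm_sq_map W)

/-- Bounded nets of operators have weak limits along ultrafilters. -/
theorem exists_tendsto_inner_of_bounded {ι : Type*} (l : Ultrafilter ι) (f : ι → H →L[ℂ] H)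
    {C : ℝ} (hC : ∀ᶠ i in (l : Filter ι), ‖f i‖ ≤ C) :
    ∃ B : H →L[ℂ] H, ∀ x y, Tendsto (fun i => ⟪x, f i y⟫_ℂ) l (𝓝 ⟪x, B y⟫_ℂ) := by
  have hC0 : 0 ≤ C := by
    obtain ⟨i, hi⟩ := hC.exists
    exact (norm_nonneg _).trans hi
  have hb : ∀ x y, ∀ᶠ i in (l : Filter ι), ‖⟪f i x, y⟫_ℂ‖ ≤ C * ‖x‖ * ‖y‖ := fun x y => by
    filter_upwards [hC] with i hi
    calc ‖⟪f i x, y⟫_ℂ‖ ≤ ‖f i x‖ * ‖y‖ := norm_inner_le_norm _ _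
      _ ≤ C * ‖x‖ * ‖y‖ := by
        gcongr
        exact (f i).le_of_opNorm_le hi _
  have hex : ∀ x y, ∃ c : ℂ, Tendsto (fun i => ⟪f i x, y⟫_ℂ) l (𝓝 c) := fun x y => by
    obtain ⟨c, -, hc⟩ := (isCompact_closedBall (0 : ℂ) (C * ‖x‖ * ‖y‖)).ultrafilter_le_nhds
      (l.map fun i => ⟪f i x, y⟫_ℂ) (by
        rw [le_principal_iff]
        refine Filter.mem_map.2 ?_
        filter_upwards [hb x y] with i hi
        simpa using hi)
    exact ⟨c, hc⟩
  choose b hlim using hex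
  have hadd : ∀ x x' y, b (x + x') y = b x y + b x' y := fun x x' y =>
    tendsto_nhds_unique (hlim _ _) (by
      simpa [inner_add_left] using (hlim x y).add (hlim x' y))
  have hsmul : ∀ (c : ℂ) x y, b (c • x) y = starRingEnd ℂ c • b x y := fun c x y =>
    tendsto_nhds_unique (hlim _ _) (by
      simpa only [_root_.map_smul, inner_smul_left, smul_eq_mul] using (hlim x y).const_mul (starRingEnd ℂ c))
  have hadd' : ∀ x y y', b x (y + y') = b x y + b x y' := fun x y y' =>
    tendsto_nhds_unique (hlim _ _) (by
      simpa [inner_add_right] using (hlim x y).add (hlim x y'))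
  have hsmul' : ∀ (c : ℂ) x y, b x (c • y) = c • b x y := fun c x y =>
    tendsto_nhds_unique (hlim _ _) (by
      simpa [inner_smul_right] using (hlim x y).const_mul c)
  let b₂ : H →L⋆[ℂ] H →L[ℂ] ℂ := (LinearMap.mk₂'ₛₗ (starRingEnd ℂ) (RingHom.id ℂ) b hadd hsmul
    hadd' hsmul').mkContinuous₂ C fun x y => by
      exact le_of_tendsto (hlim x y).norm (hb x y)
  refine ⟨(InnerProductSpace.continuousLinearMapOfBilin b₂), fun x y => ?_⟩
  have h1 : ⟪x, InnerProductSpace.continuousLinearMapOfBilin b₂ y⟫_ℂ = starRingEnd ℂ (b y x) := by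
    rw [← inner_conj_symm, InnerProductSpace.continuousLinearMapOfBilin_apply]
    rfl
  rw [h1]
  simpa only [Function.comp_def, inner_conj_symm] using
    (Complex.continuous_conj.tendsto _).comp (hlim y x)

end SigmaWeak

/-! ### Complete positivity and Stinespring's theorem on non-closed `*`-algebras. -/

section Dilation

open RKHS Finsupp

variable {H : Type u} [NormedAddCommGroup H] [InnerProductSpace ℂ H] [CompleteSpace H]

theorem CStarMatrix.re_sum_inner_nonneg {ι : Type*} [Fintype ι]
    {N : CStarMatrix ι ι (H →L[ℂ] H)} (hN : 0 ≤ N) (x : ι → H) :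
    0 ≤ (∑ i, ∑ j, ⟪x i, N i j (x j)⟫_ℂ).re := by
  rw [StarOrderedRing.nonneg_iff] at hN
  induction hN using AddSubmonoid.closure_induction with
  | mem N hN =>
    obtain ⟨R, rfl⟩ := hN
    have hsum : ∑ i, ∑ j, ⟪x i, (star R * R : CStarMatrix ι ι (H →L[ℂ] H)) i j (x j)⟫_ℂ
        = ∑ k, ⟪∑ i, R k i (x i), ∑ j, R k j (x j)⟫_ℂ := by
      have h1 : ∀ i j, ⟪x i, (star R * R : CStarMatrix ι ι (H →L[ℂ] H)) i j (x j)⟫_ℂ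
          = ∑ k, ⟪R k i (x i), R k j (x j)⟫_ℂ := fun i j => by
        simp only [CStarMatrix.mul_apply, CStarMatrix.star_apply, _root_.sum_apply, inner_sum,
          ContinuousLinearMap.star_eq_adjoint, mul_apply_eq_comp,
          ContinuousLinearMap.adjoint_inner_right]
      simp only [h1, inner_sum, sum_inner]
      rw [Finset.sum_comm_cycle]
      exact Finset.sum_congr rfl fun _ _ => Finset.sum_comm
    rw [hsum, Complex.re_sum]
    exact Finset.sum_nonneg fun k _ => inner_self_nonneg (𝕜 := ℂ)
  | zero => simp
  | add A B _ _ hA hB =>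
    simpa only [CStarMatrix.add_apply, _root_.add_apply, inner_add_right, Finset.sum_add_distrib,
      Complex.add_re] using add_nonneg hA hB

/-- Completely positive maps satisfy the positivity condition of Stinespring's theorem. -/
theorem CompletelyPositiveMap.re_sum_inner_nonneg
    (φ : (H →L[ℂ] H) →CP (H →L[ℂ] H)) {ι : Type*} [Fintype ι] (b : ι → H →L[ℂ] H) (x : ι → H) :
    0 ≤ (∑ i, ∑ j, ⟪x i, φ (star (b i) * b j) (x j)⟫_ℂ).re := by
  classical
  rcases isEmpty_or_nonempty ι with hι | ⟨⟨i₀⟩⟩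
  · simp
  -- Placing the `b j` in a single row makes `star R * R` the matrix with entries `star (b i) * b
  -- j`.
  let R : CStarMatrix ι ι (H →L[ℂ] H) := CStarMatrix.ofMatrix fun i j => if i = i₀ then b j else 0
  have hR' : ∀ i j, R i j = if i = i₀ then b j else 0 := fun i j => rfl
  have hR : ∀ i j, (star R * R) i j = star (b i) * b j := fun i j => by
    rw [CStarMatrix.mul_apply, Finset.sum_eq_single i₀]
    · simp [hR', CStarMatrix.star_apply]
    · intro k _ hk
      simp [hR', hk]
    · simp
  have := CStarMatrix.re_sum_inner_nonneg
    (φ.map_cstarMatrix_nonneg (star R * R) (star_mul_self_nonneg R)) x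
  simpa only [CStarMatrix.map_apply, hR] using this

/-- This square root turns positivity into norm bounds, both for the Stinespring representation and
for positive functionals. -/
theorem exists_star_mul_self_eq_norm_sub (c : H →L[ℂ] H) :
    ∃ d : H →L[ℂ] H, star d * d = ((‖c‖ ^ 2 : ℝ) : ℂ) • 1 - star c * c := by
  have : 0 ≤ ((‖c‖ ^ 2 : ℝ) : ℂ) • (1 : H →L[ℂ] H) - star c * c := by
    rw [ContinuousLinearMap.nonneg_iff_isPositive, ContinuousLinearMap.isPositive_iff_complex]
    intro x
    have h1 : ⟪(((‖c‖ ^ 2 : ℝ) : ℂ) • (1 : H →L[ℂ] H) - star c * c) x, x⟫_ℂ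
        = ((‖c‖ ^ 2 * ‖x‖ ^ 2 - ‖c x‖ ^ 2 : ℝ) : ℂ) := by
      simp [ContinuousLinearMap.star_eq_adjoint, ContinuousLinearMap.adjoint_inner_left,
        inner_self_eq_norm_sq_to_K, mul_comm]
    have h2 : ‖c x‖ ^ 2 ≤ (‖c‖ * ‖x‖) ^ 2 := by
      gcongr
      exact c.le_opNorm x
    rw [mul_pow] at h2
    rw [h1, RCLike.re_to_complex, Complex.ofReal_re]
    exact ⟨rfl, sub_nonneg.2 h2⟩
  obtain ⟨d, hd⟩ := CStarAlgebra.nonneg_iff_eq_star_mul_self.1 this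
  exact ⟨d, hd.symm⟩

/-- The Kolmogorov decomposition of the kernel `(a, b) ↦ Ψ (a⋆ b)`. -/
theorem exists_kolmogorov (M : StarSubalgebra ℂ (H →L[ℂ] H)) (Ψ : M →ₗ[ℂ] (H →L[ℂ] H))
    (hstar : ∀ a, Ψ (star a) = star (Ψ a))
    (hpos : ∀ {ι : Type u} [Fintype ι] (b : ι → H →L[ℂ] H) (hb : ∀ i j, star (b i) * b j ∈ M)
      (x : ι → H), 0 ≤ (∑ i, ∑ j, ⟪x i, Ψ ⟨star (b i) * b j, hb i j⟩ (x j)⟫_ℂ).re) :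
    ∃ (K : Type u) (_ : NormedAddCommGroup K) (_ : InnerProductSpace ℂ K) (_ : CompleteSpace K)
      (v : M → H →L[ℂ] K), (∀ a b x y, ⟪v a x, v b y⟫_ℂ = ⟪x, Ψ (star a * b) y⟫_ℂ) ∧
      Dense (Submodule.span ℂ {w | ∃ a x, v a x = w} : Set K) := by
  let k : Matrix M M (H →L[ℂ] H) := .of fun a b => Ψ (star a * b)
  have hk' : ∀ a b, k a b = Ψ (star a * b) := fun _ _ => rfl
  have hherm : k.IsHermitian := by
    ext1 a b
    simp [hk', ← hstar]
  have hk : Fact k.PosSemidef := ⟨by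
    have htfae := (posSemidef_tfae (K := k)).out 0 2
    refine htfae.2 ⟨hherm, fun vv => ?_⟩
    have := hpos (ι := vv.support) (fun i => ((i : M) : H →L[ℂ] H))
      (fun i j => mul_mem (star_mem i.1.2) j.1.2) (fun i => vv i)
    have h2 : ∑ i : vv.support, ∑ j : vv.support, ⟪vv i, Ψ (star (i : M) * (j : M)) (vv j)⟫_ℂ
        = vv.sum fun x w => vv.sum fun x' w' => ⟪w', k x' x w⟫_ℂ := by
      simp only [Finsupp.sum]
      rw [Finset.sum_comm, ← Finset.sum_coe_sort vv.support]
      refine Finset.sum_congr rfl fun i _ => ?_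
      rw [← Finset.sum_coe_sort vv.support]
      rfl
    have h3 : 0 ≤ (vv.sum fun x w => vv.sum fun x' w' => ⟪w', k x' x w⟫_ℂ).re := h2 ▸ this
    convert h3 using 1
    simp only [Finsupp.sum, RCLike.re_to_complex, Complex.re_sum]
    exact Finset.sum_congr rfl fun x _ => Finset.sum_congr rfl fun x' _ => inner_re_symm (𝕜 := ℂ) _ _⟩
  let v := kerFun (OfKernel k)
  have hv : ∀ a b x y, ⟪v a x, v b y⟫_ℂ = ⟪x, Ψ (star a * b) y⟫_ℂ := fun a b x y => by
    rw [← kernel_inner, OfKernel.kernel_ofKernel, ← ContinuousLinearMap.adjoint_inner_right,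
      ← ContinuousLinearMap.star_eq_adjoint, hk' b a, ← hstar]
    simp
  have hdense : Dense (Submodule.span ℂ {w | ∃ a x, v a x = w} : Set (OfKernel k)) := by
    rw [Submodule.dense_iff_topologicalClosure_eq_top]
    exact kerFun_dense _
  exact ⟨OfKernel k, inferInstance, inferInstance, inferInstance, v, hv, hdense⟩

/-- **Stinespring's theorem** for a `*`-subalgebra, not necessarily closed. -/
theorem exists_stinespring (M : StarSubalgebra ℂ (H →L[ℂ] H)) (Ψ : M →ₗ[ℂ] (H →L[ℂ] H))
    (hstar : ∀ a, Ψ (star a) = star (Ψ a))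
    (hpos : ∀ {ι : Type u} [Fintype ι] (b : ι → H →L[ℂ] H) (hb : ∀ i j, star (b i) * b j ∈ M)
      (x : ι → H), 0 ≤ (∑ i, ∑ j, ⟪x i, Ψ ⟨star (b i) * b j, hb i j⟩ (x j)⟫_ℂ).re) :
    ∃ (K : Type u) (_ : NormedAddCommGroup K) (_ : InnerProductSpace ℂ K) (_ : CompleteSpace K)
      (V : H →L[ℂ] K) (π : M →⋆ₐ[ℂ] (K →L[ℂ] K)),
      (∀ a, Ψ a = V.adjoint ∘L π a ∘L V) ∧ (∀ a, ‖π a‖ ≤ ‖a‖) ∧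
      Dense (Submodule.span ℂ {w : K | ∃ a x, w = π a (V x)} : Set K) := by
  obtain ⟨K, _, _, _, v, hv, hdense⟩ := exists_kolmogorov M Ψ hstar hpos
  let e : (M →₀ H) →ₗ[ℂ] K := Finsupp.lsum ℂ fun a => (v a).toLinearMap
  let f : M → (M →₀ H) →ₗ[ℂ] K := fun c => Finsupp.lsum ℂ fun a => (v (c * a)).toLinearMap
  have he : DenseRange e := by
    refine hdense.mono ?_
    change (_ : Set (K)) ⊆ (LinearMap.range e : Set (K))
    rw [SetLike.coe_subset_coe, Submodule.span_le]
    rintro _ ⟨a, x, rfl⟩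
    exact ⟨Finsupp.single a x, by simp [e]⟩
  have hf : ∀ c g, ‖f c g‖ ≤ ‖c‖ * ‖e g‖ := fun c g => by
    have hfg : f c g = ∑ a : g.support, v (c * a) (g a) := by
      simp only [f, Finsupp.lsum_apply, Finsupp.sum]
      exact (Finset.sum_coe_sort g.support (fun a => v (c * a) (g a))).symm
    have heg : e g = ∑ a : g.support, v a (g a) := by
      simp only [e, Finsupp.lsum_apply, Finsupp.sum]
      exact (Finset.sum_coe_sort g.support (fun a => v a (g a))).symm
    -- The root `d` need not lie in `M`, but the products `(d a)* (d b)` do. This is why `hpos`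
    -- allows `b i` outside `M`. Applied to `d a`, it reads `‖f c g‖² ≤ ‖c‖² ‖e g‖²`.
    obtain ⟨d, hd⟩ := exists_star_mul_self_eq_norm_sub (c : H →L[ℂ] H)
    have hmem : ∀ a b : M, star (d * (a : H →L[ℂ] H)) * (d * (b : H →L[ℂ] H))
        = ((((‖c‖ ^ 2 : ℝ) : ℂ) • (star a * b) - star (c * a) * (c * b) : M) : H →L[ℂ] H) := by
      intro a b
      have : star (d * (a : H →L[ℂ] H)) * (d * (b : H →L[ℂ] H))
        = star (a : H →L[ℂ] H) * (star d * d) * b := by simp only [star_mul, mul_assoc]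
      rw [this, hd]
      simp [mul_sub, sub_mul, mul_assoc]
    have hp := hpos (ι := g.support) (fun i => d * ((i : M) : H →L[ℂ] H))
      (fun i j => by rw [hmem]; exact Subtype.coe_prop _) (fun i => g i)
    simp only [hmem, Subtype.coe_eta, map_sub, map_smul, _root_.sub_apply, _root_.smul_apply,
      inner_sub_right, inner_smul_right, Finset.sum_sub_distrib, ← Finset.mul_sum, ← hv,
      ← sum_inner, ← inner_sum] at hp
    rw [← hfg, ← heg, inner_self_eq_norm_sq_to_K, inner_self_eq_norm_sq_to_K] at hp
    have hp' : 0 ≤ ‖c‖ ^ 2 * ‖e g‖ ^ 2 - ‖f c g‖ ^ 2 := by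
      simpa [← Complex.ofReal_pow] using hp
    refine le_of_sq_le_sq ?_ (by positivity)
    rw [mul_pow]
    linarith
  -- The bound makes `∑ v(a) xₐ ↦ ∑ v(ca) xₐ` well defined on a dense subspace, and it extends to
  -- `K`; here `v a` plays the role of `π(a)V`.
  let π₀ : M → K →L[ℂ] K := fun c => (f c).extendOfNorm e
  have hπ₀ : ∀ c a x, π₀ c (v a x) = v (c * a) x := fun c a x => by
    have := LinearMap.extendOfNorm_eq (f := f c) he ⟨‖c‖, hf c⟩ (Finsupp.single a x)
    simpa only [e, f, Finsupp.lsum_single, ContinuousLinearMap.coe_coe] using this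
  have hext : ∀ A B : K →L[ℂ] K, (∀ a x, A (v a x) = B (v a x)) → A = B :=
    fun A B h => ContinuousLinearMap.ext_on hdense (by
      rintro _ ⟨a, x, rfl⟩
      exact h a x)
  have hext_left : ∀ z w : K, (∀ b y, ⟪v b y, z⟫_ℂ = ⟪v b y, w⟫_ℂ) → z = w :=
    fun z w h => by
      have := ContinuousLinearMap.ext_on (f := (innerSL ℂ z : K →L[ℂ] ℂ))
        (g := innerSL ℂ w) hdense (by
          rintro _ ⟨b, y, rfl⟩
          simpa using congrArg (starRingEnd ℂ) (h b y))
      exact ext_inner_right ℂ fun y => DFunLike.congr_fun this y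
  -- The decomposition does not supply linearity of `v` in the algebra variable; it is recovered by
  -- testing against the total vectors.
  have hvadd : ∀ a b x, v (a + b) x = v a x + v b x := fun a b x => by
    refine hext_left _ _ fun b y => ?_
    simp only [inner_add_right, hv, mul_add, map_add, _root_.add_apply]
  have hvsmul : ∀ (r : ℂ) a x, v (r • a) x = r • v a x := fun r a x => by
    refine hext_left _ _ fun b y => ?_
    simp only [inner_smul_right, hv, mul_smul_comm, map_smul, _root_.smul_apply]
  let π : M →⋆ₐ[ℂ] (K →L[ℂ] K) :=
    { toFun := π₀
      map_one' := hext _ _ fun a x => by simp [hπ₀]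
      map_mul' := fun c d => hext _ _ fun a x => by simp [hπ₀, mul_assoc]
      map_zero' := hext _ _ fun a x => by
        rw [hπ₀, zero_mul, ← zero_smul ℂ (0 : M), hvsmul, zero_smul]
        rfl
      map_add' := fun c d => hext _ _ fun a x => by simp [hπ₀, add_mul, hvadd]
      commutes' := fun r => hext _ _ fun a x => by
        simp [hπ₀, Algebra.algebraMap_eq_smul_one, hvsmul]
      map_star' := fun c => by
        refine hext _ _ fun a x => hext_left _ _ fun b y => ?_
        rw [ContinuousLinearMap.star_eq_adjoint, ContinuousLinearMap.adjoint_inner_right]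
        simp only [hπ₀, hv, star_mul, mul_assoc] }
  refine ⟨K, inferInstance, inferInstance, inferInstance, v 1, π, fun a => ?_, fun a => ?_,
    ?_⟩
  · ext x
    refine ext_inner_left ℂ fun y => ?_
    rw [ContinuousLinearMap.comp_apply, ContinuousLinearMap.adjoint_inner_right,
      ContinuousLinearMap.comp_apply]
    change _ = ⟪v 1 y, π₀ a (v 1 x)⟫_ℂ
    rw [hπ₀, hv]
    simp
  · exact ContinuousLinearMap.opNorm_le_bound _ (norm_nonneg a)
      (LinearMap.norm_extendOfNorm_apply_le he _ (hf a))
  · refine hdense.mono (Submodule.span_mono ?_)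
    rintro _ ⟨a, x, rfl⟩
    exact ⟨a, x, by
      change _ = π₀ a (v 1 x)
      rw [hπ₀, mul_one]⟩

end Dilation

/-! ### Positive functionals given by trace class operators. -/

section NormalFunctional

open InnerProductSpace ComplexOrder

variable {H : Type*} [NormedAddCommGroup H] [InnerProductSpace ℂ H] [CompleteSpace H]

/-- Cauchy–Schwarz in the pre-GNS space of `ψ`. -/
theorem PositiveLinearMap.norm_map_star_mul_le (ψ : (H →L[ℂ] H) →ₚ[ℂ] ℂ) (A B : H →L[ℂ] H) :
    ‖ψ (star A * B)‖ ≤ √(ψ (star A * A)).re * √(ψ (star B * B)).re :=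
  norm_inner_le_norm (𝕜 := ℂ) (ψ.toPreGNS A) (ψ.toPreGNS B)

theorem PositiveLinearMap.re_map_star_mul_self_le (ψ : (H →L[ℂ] H) →ₚ[ℂ] ℂ) (A : H →L[ℂ] H) :
    (ψ (star A * A)).re ≤ ‖A‖ ^ 2 * (ψ 1).re := by
  obtain ⟨D, hD⟩ := exists_star_mul_self_eq_norm_sub A
  have := (Complex.nonneg_iff.1 (map_nonneg ψ (star_mul_self_nonneg D))).1
  rw [hD, map_sub, map_smul, Complex.sub_re, smul_eq_mul, Complex.re_ofReal_mul] at this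
  linarith

theorem PositiveLinearMap.re_map_one_nonneg (ψ : (H →L[ℂ] H) →ₚ[ℂ] ℂ) : 0 ≤ (ψ 1).re :=
  (Complex.nonneg_iff.1 (map_nonneg ψ zero_le_one)).1

theorem PositiveLinearMap.norm_map_le (ψ : (H →L[ℂ] H) →ₚ[ℂ] ℂ) (A : H →L[ℂ] H) :
    ‖ψ A‖ ≤ (ψ 1).re * ‖A‖ := by
  have h := ψ.norm_map_star_mul_le 1 A
  simp only [star_one, one_mul] at h
  refine h.trans ?_
  calc √(ψ 1).re * √(ψ (star A * A)).re ≤ √(ψ 1).re * √(‖A‖ ^ 2 * (ψ 1).re) := by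
        gcongr
        exact ψ.re_map_star_mul_self_le A
    _ = (√(ψ 1).re * √(ψ 1).re) * ‖A‖ := by
        rw [Real.sqrt_mul (sq_nonneg _), Real.sqrt_sq (norm_nonneg _)]
        ring
    _ = (ψ 1).re * ‖A‖ := by rw [Real.mul_self_sqrt ψ.re_map_one_nonneg]

/-- A positive functional is given on rank one operators by a square. -/
theorem PositiveLinearMap.exists_map_rankOne_eq (ψ : (H →L[ℂ] H) →ₚ[ℂ] ℂ) :
    ∃ R : H →L[ℂ] H, IsSelfAdjoint R ∧ ∀ x y, ψ (rankOne ℂ x y) = ⟪R y, R x⟫_ℂ := by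
  -- The sesquilinear form is bounded, so a positive density operator `ρ` represents it; `R` is a
  -- self-adjoint square root of `ρ`.
  let b : H →L⋆[ℂ] H →L[ℂ] ℂ := (LinearMap.mk₂'ₛₗ (starRingEnd ℂ) (RingHom.id ℂ)
    (fun y x => ψ (rankOne ℂ x y)) (by simp) (by simp) (by simp) (by simp)).mkContinuous₂ (ψ 1).re
      fun y x => by
        refine (ψ.norm_map_le _).trans_eq ?_
        rw [norm_rankOne]
        ring
  let ρ := continuousLinearMapOfBilin b
  have hρ : ∀ x y, ⟪ρ y, x⟫_ℂ = ψ (rankOne ℂ x y) := fun x y =>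
    continuousLinearMapOfBilin_apply b y x
  have hpos : 0 ≤ ρ := by
    rw [ContinuousLinearMap.nonneg_iff_isPositive, ContinuousLinearMap.isPositive_iff_complex]
    intro x
    have h0 : 0 ≤ ⟪ρ x, x⟫_ℂ := by
      rw [hρ]
      refine map_nonneg ψ ?_
      rw [ContinuousLinearMap.nonneg_iff_isPositive]
      exact isPositive_rankOne_self x
    obtain ⟨h1, h2⟩ := Complex.nonneg_iff.1 h0
    exact ⟨Complex.ext (by simp) (by simpa using h2), h1⟩
  obtain ⟨R, hR, hRρ⟩ := CStarAlgebra.nonneg_iff_exists_isSelfAdjoint_and_eq_mul_self.1 hpos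
  refine ⟨R, hR, fun x y => ?_⟩
  rw [← hρ, hRρ, mul_apply_eq_comp]
  nth_rw 1 [← hR.star_eq]
  rw [ContinuousLinearMap.star_eq_adjoint, ContinuousLinearMap.adjoint_inner_left]

-- A square-summable family has countable support, so a basis of a non-separable space can still be
-- reindexed by `ℕ`.
omit [CompleteSpace H] in
theorem exists_nat_tsum_inner_eq {ι : Type*} (w : ι → H) (hw : Summable fun i => ‖w i‖ ^ 2) :
    ∃ w' : ℕ → H, (Summable fun n => ‖w' n‖ ^ 2) ∧
      ∀ A : H →L[ℂ] H, ∑' n, ⟪w' n, A (w' n)⟫_ℂ = ∑' i, ⟪w i, A (w i)⟫_ℂ := by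
  have hc := hw.countable_support
  have hsub : ∀ i, i ∉ Function.support (fun i => ‖w i‖ ^ 2) → w i = 0 := fun i hi => by
    simpa using hi
  set s := Function.support (fun i => ‖w i‖ ^ 2)
  obtain ⟨j, hj⟩ := hc.exists_injective_nat
  let w' : ℕ → H := Function.extend j (fun i : s => w i) 0
  have hw'j : ∀ i, w' (j i) = w i := fun i => hj.extend_apply _ _ _
  have hw'0 : ∀ n, n ∉ Set.range j → w' n = 0 := fun n hn => by
    simp only [w']
    rw [Function.extend_apply' _ _ _ (by simpa using hn)]
    rfl
  refine ⟨w', ?_, fun A => ?_⟩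
  · rw [← hj.summable_iff (fun n hn => by simp [hw'0 n hn])]
    simp only [Function.comp_def, hw'j]
    exact hw.subtype s
  · rw [← hj.tsum_eq (f := fun n => ⟪w' n, A (w' n)⟫_ℂ)]
    · simp only [hw'j]
      exact tsum_subtype_eq_of_support_subset (f := fun i => ⟪w i, A (w i)⟫_ℂ) fun i hi => by
        by_contra h
        exact hi (by simp [hsub i h])
    · intro n hn
      by_contra h
      exact hn (by simp [hw'0 n h])

section PartialProj

variable {ι : Type*} (e : HilbertBasis ι ℂ H)

/-- The orthogonal projection onto the span of finitely many vectors of a Hilbert basis. -/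
noncomputable def HilbertBasis.partialProj (F : Finset ι) : H →L[ℂ] H :=
  ∑ i ∈ F, rankOne ℂ (e i) (e i)

namespace HilbertBasis

omit [CompleteSpace H] in
theorem partialProj_apply (F : Finset ι) (x : H) :
    e.partialProj F x = ∑ i ∈ F, ⟪e i, x⟫_ℂ • e i := by
  simp [partialProj]

theorem star_partialProj (F : Finset ι) : star (e.partialProj F) = e.partialProj F := by
  simp [partialProj, ContinuousLinearMap.star_eq_adjoint]

omit [CompleteSpace H] in
theorem partialProj_apply_basis {F : Finset ι} {i : ι} (hi : i ∈ F) :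
    e.partialProj F (e i) = e i := by
  classical
  rw [partialProj_apply, Finset.sum_eq_single_of_mem i hi]
  · simp [e.orthonormal.1 i]
  · intro j _ hj
    simp [e.orthonormal.2 hj]

omit [CompleteSpace H] in
theorem partialProj_mul_self (F : Finset ι) :
    e.partialProj F * e.partialProj F = e.partialProj F := by
  ext x
  rw [mul_apply_eq_comp]
  nth_rw 2 3 [partialProj_apply]
  rw [map_sum]
  exact Finset.sum_congr rfl fun i hi => by rw [map_smul, e.partialProj_apply_basis hi]

theorem star_one_sub_partialProj (F : Finset ι) :
    star (1 - e.partialProj F) = 1 - e.partialProj F := by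
  rw [star_sub, star_one, e.star_partialProj]

omit [CompleteSpace H] in
theorem one_sub_partialProj_mul_self (F : Finset ι) :
    (1 - e.partialProj F) * (1 - e.partialProj F) = 1 - e.partialProj F := by
  rw [mul_sub, sub_mul, sub_mul, e.partialProj_mul_self]
  simp

theorem norm_partialProj_apply_le (F : Finset ι) (x : H) : ‖e.partialProj F x‖ ≤ ‖x‖ := by
  have h1 : ‖e.partialProj F x‖ * ‖e.partialProj F x‖ ≤ ‖x‖ * ‖e.partialProj F x‖ := by
    have h2 : ⟪e.partialProj F x, e.partialProj F x⟫_ℂ = ⟪x, e.partialProj F x⟫_ℂ := by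
      nth_rw 1 [← e.star_partialProj]
      rw [ContinuousLinearMap.star_eq_adjoint, ContinuousLinearMap.adjoint_inner_left,
        ← mul_apply_eq_comp, e.partialProj_mul_self]
    calc ‖e.partialProj F x‖ * ‖e.partialProj F x‖ = ‖⟪x, e.partialProj F x⟫_ℂ‖ := by
          rw [← h2, inner_self_eq_norm_sq_to_K]
          simp [sq]
      _ ≤ ‖x‖ * ‖e.partialProj F x‖ := norm_inner_le_norm _ _
  rcases (norm_nonneg (e.partialProj F x)).eq_or_lt with h | h
  · rw [← h]
    exact norm_nonneg x
  · exact le_of_mul_le_mul_right h1 h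

theorem one_sub_partialProj_nonneg (F : Finset ι) : 0 ≤ 1 - e.partialProj F := by
  nth_rw 1 [← e.one_sub_partialProj_mul_self F, ← e.star_one_sub_partialProj F]
  exact star_mul_self_nonneg _

theorem partialProj_mono {F G : Finset ι} (h : F ⊆ G) : e.partialProj F ≤ e.partialProj G := by
  refine Finset.sum_le_sum_of_subset_of_nonneg h fun i _ _ => ?_
  rw [ContinuousLinearMap.nonneg_iff_isPositive]
  exact isPositive_rankOne_self (e i)

omit [CompleteSpace H] in
theorem tendsto_partialProj_apply (x : H) :
    Tendsto (fun F => e.partialProj F x) atTop (𝓝 x) := by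
  simp only [partialProj_apply, ← e.repr_apply_apply]
  exact e.hasSum_repr x

end HilbertBasis

end PartialProj

/-- A positive functional that is continuous along the finite rank projections of a Hilbert basis is
given by a positive trace class operator. -/
theorem PositiveLinearMap.exists_eq_tsum_inner (ψ : (H →L[ℂ] H) →ₚ[ℂ] ℂ) {ι : Type*}
    (e : HilbertBasis ι ℂ H)
    (hlim : Tendsto (fun F : Finset ι => (ψ (1 - e.partialProj F)).re) atTop (𝓝 0)) :
    ∃ w : ℕ → H, (Summable fun n => ‖w n‖ ^ 2) ∧ ∀ A, ψ A = ∑' n, ⟪w n, A (w n)⟫_ℂ := by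
  obtain ⟨R, hR, hψR⟩ := ψ.exists_map_rankOne_eq
  have hRs : ∀ x y, ⟪R x, y⟫_ℂ = ⟪x, R y⟫_ℂ := fun x y => by
    nth_rw 1 [← hR.star_eq]
    rw [ContinuousLinearMap.star_eq_adjoint, ContinuousLinearMap.adjoint_inner_left]
  -- The partial sums are the values of `ψ` on the projections, hence at most `ψ 1`.
  have hw : Summable fun i => ‖R (e i)‖ ^ 2 := by
    refine summable_of_sum_le (c := (ψ 1).re) (fun i => sq_nonneg _) fun F => ?_
    have h1 := (Complex.nonneg_iff.1 (map_nonneg ψ (e.one_sub_partialProj_nonneg F))).1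
    rw [map_sub, HilbertBasis.partialProj, map_sum, Complex.sub_re, Complex.re_sum] at h1
    simp only [hψR, inner_self_eq_norm_sq_to_K] at h1
    simpa [← Complex.ofReal_pow] using h1
  obtain ⟨w, hws, hwA⟩ := exists_nat_tsum_inner_eq (fun i => R (e i)) hw
  refine ⟨w, hws, fun A => ?_⟩
  rw [hwA]
  have hrank : ∀ x y, ∑' i, ⟪R (e i), rankOne ℂ x y (R (e i))⟫_ℂ = ψ (rankOne ℂ x y) :=
    fun x y => by
      rw [hψR, ← e.tsum_inner_mul_inner (R y) (R x)]
      refine tsum_congr fun i => ?_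
      rw [rankOne_apply, inner_smul_right, hRs y, hRs (e i)]
  have hAP : ∀ F, A * e.partialProj F = ∑ i ∈ F, rankOne ℂ (A (e i)) (e i) := fun F => by
    simp only [HilbertBasis.partialProj, Finset.mul_sum]
    exact Finset.sum_congr rfl fun i _ => comp_rankOne _ _ _
  have hsum : ∀ B : H →L[ℂ] H, Summable fun i => ⟪R (e i), B (R (e i))⟫_ℂ := fun B => by
    refine Summable.of_norm_bounded (g := fun i => ‖B‖ * ‖R (e i)‖ ^ 2) (hw.mul_left _) fun i => ?_
    calc ‖⟪R (e i), B (R (e i))⟫_ℂ‖ ≤ ‖R (e i)‖ * ‖B (R (e i))‖ := norm_inner_le_norm _ _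
      _ ≤ ‖R (e i)‖ * (‖B‖ * ‖R (e i)‖) := by
          gcongr
          exact B.le_opNorm _
      _ = _ := by ring
  have heq : ∀ F, ψ (A * e.partialProj F) = ∑' i, ⟪R (e i), (A * e.partialProj F) (R (e i))⟫_ℂ := fun F => by
    rw [hAP, map_sum]
    simp only [_root_.sum_apply, inner_sum]
    rw [Summable.tsum_finsetSum fun j _ => hsum _]
    exact Finset.sum_congr rfl fun j _ => (hrank _ _).symm
  -- Both sides agree on the finite rank operators `A P_F`. By Cauchy–Schwarz the error of `ψ` is at
  -- most `√ψ(A A*) √ψ(1 - P_F)`, which `hlim` sends to zero.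
  have hl1 : Tendsto (fun F => ψ (A * e.partialProj F)) atTop (𝓝 (ψ A)) := by
    rw [tendsto_iff_norm_sub_tendsto_zero]
    have hb : ∀ F, ‖ψ (A * e.partialProj F) - ψ A‖ ≤ √(ψ (A * star A)).re * √(ψ (1 - e.partialProj F)).re := fun F => by
      have h1 : ψ (A * e.partialProj F) - ψ A = - ψ (star (star A) * (1 - e.partialProj F)) := by
        rw [star_star, mul_sub, mul_one, map_sub]
        ring
      have h2 := ψ.norm_map_star_mul_le (star A) (1 - e.partialProj F)
      rw [e.star_one_sub_partialProj, e.one_sub_partialProj_mul_self, star_star] at h2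
      rwa [h1, norm_neg, star_star]
    refine squeeze_zero (fun _ => norm_nonneg _) hb ?_
    have := ((Real.continuous_sqrt.tendsto 0).comp hlim).const_mul (√(ψ (A * star A)).re)
    rwa [Real.sqrt_zero, mul_zero] at this
  have hl2 : Tendsto (fun F => ψ (A * e.partialProj F)) atTop (𝓝 (∑' i, ⟪R (e i), A (R (e i))⟫_ℂ)) := by
    simp only [heq]
    refine tendsto_tsum_of_dominated_convergence
      (bound := fun i => ‖A‖ * ‖R (e i)‖ ^ 2) (hw.mul_left _) (fun i => ?_)
      (Eventually.of_forall fun F i => ?_)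
    · have hP : Tendsto (fun F => e.partialProj F (R (e i))) atTop (𝓝 (R (e i))) :=
        e.tendsto_partialProj_apply _
      exact (continuous_const.inner A.continuous).tendsto _ |>.comp hP
    · calc ‖⟪R (e i), (A * e.partialProj F) (R (e i))⟫_ℂ‖ ≤ ‖R (e i)‖ * ‖A (e.partialProj F (R (e i)))‖ :=
            norm_inner_le_norm _ _
        _ ≤ ‖R (e i)‖ * (‖A‖ * ‖R (e i)‖) := by
            gcongr
            exact (A.le_opNorm _).trans (by gcongr; exact e.norm_partialProj_apply_le F _)
        _ = _ := by ring
  exact tendsto_nhds_unique hl1 hl2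

end NormalFunctional

/-! ### Contractivity, the integrated generator equation, and normality of time integrals. -/

namespace QuantumMarkovSemigroup

open InnerProductSpace MeasureTheory ComplexOrder

variable {H : Type u} [NormedAddCommGroup H] [InnerProductSpace ℂ H] [CompleteSpace H]
  (S : QuantumMarkovSemigroup H)

theorem map_star (t : ℝ≥0) (A : H →L[ℂ] H) : S.toFun t (star A) = star (S.toFun t A) :=
  StarHomClass.map_star (S.toFun t) A

/-- Stinespring's theorem for `T_t` on all of `B(H)`; unitality of `T_t` makes `V` an isometry. -/
theorem exists_dilation (t : ℝ≥0) :
    ∃ (K : Type u) (_ : NormedAddCommGroup K) (_ : InnerProductSpace ℂ K) (_ : CompleteSpace K)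
      (V : H →L[ℂ] K) (π : (H →L[ℂ] H) →⋆ₐ[ℂ] (K →L[ℂ] K)), ‖V‖ ≤ 1 ∧ V.adjoint ∘L V = 1 ∧
      (∀ A, S.toFun t A = V.adjoint ∘L π A ∘L V) ∧ ∀ A, ‖π A‖ ≤ ‖A‖ := by
  obtain ⟨K, _, _, _, V, π, hV, hπ, -⟩ := exists_stinespring (⊤ : StarSubalgebra ℂ (H →L[ℂ] H))
    ((S.toFun t).toLinearMap ∘ₗ (⊤ : StarSubalgebra ℂ (H →L[ℂ] H)).toSubalgebra.val.toLinearMap)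
    (fun a => S.map_star t a) (fun b hb x => (S.toFun t).re_sum_inner_nonneg b x)
  let ι : (H →L[ℂ] H) →⋆ₐ[ℂ] (⊤ : StarSubalgebra ℂ (H →L[ℂ] H)) :=
    (StarAlgHom.id ℂ (H →L[ℂ] H)).codRestrict ⊤ fun _ => trivial
  have hVV : V.adjoint ∘L V = 1 := by
    have h1 := hV 1
    rw [_root_.map_one π] at h1
    exact h1.symm.trans (S.map_one t)
  refine ⟨K, inferInstance, inferInstance, inferInstance, V, π.comp ι, ?_, hVV, fun A => hV (ι A),
    fun A => hπ (ι A)⟩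
  refine V.opNorm_le_bound zero_le_one fun x => ?_
  have h2 : ⟪V x, V x⟫_ℂ = ⟪x, x⟫_ℂ := by
    rw [← ContinuousLinearMap.adjoint_inner_right, ← ContinuousLinearMap.comp_apply, hVV]
    rfl
  rw [inner_self_eq_norm_sq_to_K, inner_self_eq_norm_sq_to_K] at h2
  have h3 : ‖V x‖ ^ 2 = ‖x‖ ^ 2 := by exact_mod_cast h2
  rw [one_mul, (sq_eq_sq₀ (norm_nonneg _) (norm_nonneg _)).1 h3]

theorem norm_map_le (t : ℝ≥0) (A : H →L[ℂ] H) : ‖S.toFun t A‖ ≤ ‖A‖ := by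
  obtain ⟨K, _, _, _, V, π, hV1, -, hV, hπ⟩ := S.exists_dilation t
  rw [hV]
  calc ‖V.adjoint ∘L π A ∘L V‖ ≤ ‖V.adjoint‖ * (‖π A‖ * ‖V‖) :=
        (ContinuousLinearMap.opNorm_comp_le _ _).trans
          (mul_le_mul_of_nonneg_left (ContinuousLinearMap.opNorm_comp_le _ _) (norm_nonneg _))
    _ ≤ 1 * (‖A‖ * 1) := by
        gcongr
        · rwa [LinearIsometryEquiv.norm_map]
        · exact hπ A
    _ = ‖A‖ := by ring

theorem continuous_inner (A : H →L[ℂ] H) (x y : H) :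
    Continuous fun s : ℝ => ⟪x, S.toFun s.toNNReal A y⟫_ℂ := by
  have h1 : Continuous fun s : ℝ≥0 => ⟪x, S.toFun s A y⟫_ℂ := by
    rw [continuous_iff_continuousAt]
    intro s
    have h2 : SigmaWeakTendsto (fun s => S.toFun s A) (𝓝 s) (S.toFun s A) :=
      @Continuous.tendsto _ _ _ (sigmaWeak H) _ (S.orbit_continuous A) s
    exact h2.inner x y
  exact h1.comp continuous_real_toNNReal

theorem _root_.SigmaWeakTendsto.map {ι : Type*} {l : Filter ι} {f : ι → H →L[ℂ] H} {B : H →L[ℂ] H}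
    (hf : SigmaWeakTendsto f l B) (t : ℝ≥0) :
    SigmaWeakTendsto (fun i => S.toFun t (f i)) l (S.toFun t B) :=
  (@Continuous.tendsto _ _ (sigmaWeak H) (sigmaWeak H) _ (S.sigmaWeak_continuous t) B).comp hf

variable {S}

/-- By the semigroup law the quotient at `s` is `T_s` applied to the quotient at `0`, and `T_s` is
σ-weakly continuous. A right derivative is enough for the fundamental theorem of calculus used next.
-/
theorem IsDerivAtZero.hasDerivWithinAt {A B : H →L[ℂ] H} (h : S.IsDerivAtZero A B) (x y : H)
    {s : ℝ} (hs : 0 ≤ s) : HasDerivWithinAt (fun r : ℝ => ⟪x, S.toFun r.toNNReal A y⟫_ℂ)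
      ⟪x, S.toFun s.toNNReal B y⟫_ℂ (Set.Ioi s) s := by
  rw [hasDerivWithinAt_iff_tendsto_slope' (by simp)]
  have h1 : Tendsto (fun r : ℝ => (r - s).toNNReal) (𝓝[>] s) (𝓝[>] 0) := by
    refine tendsto_nhdsWithin_of_tendsto_nhds_of_eventually_within _ ?_ ?_
    · have : Continuous fun r : ℝ => (r - s).toNNReal := by fun_prop
      simpa using (this.tendsto s).mono_left nhdsWithin_le_nhds
    · filter_upwards [self_mem_nhdsWithin] with r hr
      simpa using hr
  refine ((((SigmaWeakTendsto.map S h s.toNNReal).inner x y).comp h1)).congr' ?_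
  filter_upwards [self_mem_nhdsWithin] with r hr
  have hr' : s < r := hr
  have hadd : r.toNNReal = s.toNNReal + (r - s).toNNReal := by
    rw [← Real.toNNReal_add hs (by linarith)]
    congr 1
    ring
  simp only [Function.comp_apply, slope_def_module, hadd, S.map_add, map_smul, map_sub,
    _root_.smul_apply, _root_.sub_apply, inner_smul_right, inner_sub_right,
    Real.coe_toNNReal _ (sub_nonneg.2 hr'.le)]
  rw [Complex.real_smul, Complex.ofReal_inv]

theorem IsDerivAtZero.inner_sub_eq_integral {A B : H →L[ℂ] H} (h : S.IsDerivAtZero A B)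
    (x y : H) (t : ℝ≥0) :
    ⟪x, (S.toFun t A - A) y⟫_ℂ = ∫ s in (0 : ℝ)..t, ⟪x, S.toFun s.toNNReal B y⟫_ℂ := by
  rw [intervalIntegral.integral_eq_sub_of_hasDeriv_right_of_le t.coe_nonneg
    (f := fun r : ℝ => ⟪x, S.toFun r.toNNReal A y⟫_ℂ) (S.continuous_inner A x y).continuousOn
    (fun s hs => h.hasDerivWithinAt x y hs.1.le)
    ((S.continuous_inner B x y).intervalIntegrable _ _)]
  simp [S.map_zero]

omit [CompleteSpace H] in
theorem _root_.ContinuousLinearMap.opNorm_le_of_inner_le {K : Type*} [NormedAddCommGroup K]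
    [InnerProductSpace ℂ K] {A : H →L[ℂ] K} {C : ℝ} (hC : 0 ≤ C)
    (h : ∀ x y, ‖⟪x, A y⟫_ℂ‖ ≤ C * ‖x‖ * ‖y‖) : ‖A‖ ≤ C := by
  refine A.opNorm_le_bound hC fun y => ?_
  have h1 := h (A y) y
  rw [inner_self_eq_norm_sq_to_K] at h1
  rcases (norm_nonneg (A y)).eq_or_lt with h0 | h0
  · rw [← h0]
    positivity
  · have h2 : ‖A y‖ * ‖A y‖ ≤ (C * ‖y‖) * ‖A y‖ := by
      calc ‖A y‖ * ‖A y‖ = ‖((‖A y‖ : ℂ)) ^ 2‖ := by simp [sq]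
        _ ≤ _ := h1
        _ = _ := by ring
    exact le_of_mul_le_mul_right h2 h0

theorem IsDerivAtZero.norm_sub_le {A B : H →L[ℂ] H} (h : S.IsDerivAtZero A B) (t : ℝ≥0) :
    ‖S.toFun t A - A‖ ≤ ‖B‖ * t := by
  refine ContinuousLinearMap.opNorm_le_of_inner_le (by positivity) fun x y => ?_
  rw [h.inner_sub_eq_integral]
  refine (intervalIntegral.norm_integral_le_of_norm_le_const (C := ‖x‖ * (‖B‖ * ‖y‖))
    fun s _ => ?_).trans_eq ?_
  · refine (norm_inner_le_norm _ _).trans ?_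
    gcongr
    exact (S.toFun _ B).le_of_opNorm_le (S.norm_map_le _ B) y
  · rw [sub_zero, abs_of_nonneg t.coe_nonneg]
    ring

variable (S)

/-- The functional `X ↦ ∫₀ᵗ ⟨x, T_s X x⟩ ds`. -/
noncomputable def integralFunctional (x : H) (t : ℝ≥0) : (H →L[ℂ] H) →ₚ[ℂ] ℂ :=
  PositiveLinearMap.mk₀
    { toFun := fun A => ∫ s in (0 : ℝ)..t, ⟪x, S.toFun s.toNNReal A x⟫_ℂ
      map_add' := fun A B => by
        rw [← intervalIntegral.integral_add ((S.continuous_inner A x x).intervalIntegrable _ _)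
          ((S.continuous_inner B x x).intervalIntegrable _ _)]
        simp
      map_smul' := fun c A => by
        simp }
    fun A hA => by
      have h1 : ∀ s : ℝ, 0 ≤ ⟪x, S.toFun s.toNNReal A x⟫_ℂ := fun s => by
        have := map_nonneg (S.toFun s.toNNReal) hA
        rw [ContinuousLinearMap.nonneg_iff_isPositive] at this
        exact this.inner_nonneg_right x
      have h2 : ∀ s : ℝ, ⟪x, S.toFun s.toNNReal A x⟫_ℂ
          = ((⟪x, S.toFun s.toNNReal A x⟫_ℂ).re : ℂ) := fun s =>
        Complex.ext rfl (by simpa using (Complex.nonneg_iff.1 (h1 s)).2.symm)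
      change 0 ≤ ∫ s in (0 : ℝ)..t, ⟪x, S.toFun s.toNNReal A x⟫_ℂ
      rw [intervalIntegral.integral_congr fun s _ => h2 s, intervalIntegral.integral_ofReal]
      exact Complex.zero_le_real.2 (intervalIntegral.integral_nonneg t.coe_nonneg fun s _ =>
        (Complex.nonneg_iff.1 (h1 s)).1)

theorem integralFunctional_apply (x : H) (t : ℝ≥0) (A : H →L[ℂ] H) :
    S.integralFunctional x t A = ∫ s in (0 : ℝ)..t, ⟪x, S.toFun s.toNNReal A x⟫_ℂ := rfl

/-- The functions `s ↦ ⟨x, T_s(1 - P_F) x⟩` are continuous and decrease pointwise to `0`, since each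
`T_s` is normal. Dini's theorem makes the convergence uniform on `[0, t]`, so the integrals tend to
`0` even though `F` runs over a net, where dominated convergence could fail. -/
theorem exists_integralFunctional_eq_tsum (x : H) (t : ℝ≥0) :
    ∃ w : ℕ → H, (Summable fun n => ‖w n‖ ^ 2) ∧
      ∀ A, S.integralFunctional x t A = ∑' n, ⟪w n, A (w n)⟫_ℂ := by
  obtain ⟨b, e, -⟩ := exists_hilbertBasis ℂ H
  refine (S.integralFunctional x t).exists_eq_tsum_inner e ?_
  let g : Finset b → ℝ → ℝ := fun F s => (⟪x, S.toFun s.toNNReal (1 - e.partialProj F) x⟫_ℂ).re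
  have hcont : ∀ F, Continuous (g F) := fun F =>
    Complex.continuous_re.comp (S.continuous_inner _ x x)
  have hanti : ∀ s, Antitone (g · s) := fun s F G hFG => by
    have h1 : 0 ≤ (1 - e.partialProj F) - (1 - e.partialProj G) := by
      simpa using e.partialProj_mono hFG
    have h2 := map_nonneg (S.toFun s.toNNReal) h1
    rw [ContinuousLinearMap.nonneg_iff_isPositive] at h2
    have h3 := (Complex.nonneg_iff.1 (h2.inner_nonneg_right x)).1
    rw [map_sub, _root_.sub_apply, inner_sub_right, Complex.sub_re] at h3
    exact sub_nonneg.1 h3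
  have hsw : SigmaWeakTendsto (fun F => 1 - e.partialProj F) atTop 0 := by
    refine sigmaWeakTendsto_of_bounded (C := 2) (Eventually.of_forall fun F => ?_) fun y => ?_
    · refine ContinuousLinearMap.opNorm_le_bound _ zero_le_two fun y => ?_
      calc ‖y - e.partialProj F y‖ ≤ ‖y‖ + ‖e.partialProj F y‖ := _root_.norm_sub_le _ _
        _ ≤ 2 * ‖y‖ := by linarith [e.norm_partialProj_apply_le F y]
    · have := (tendsto_const_nhds (x := y)).inner ((tendsto_const_nhds (x := y)).sub
        (e.tendsto_partialProj_apply y)) (𝕜 := ℂ)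
      simpa [inner_sub_right] using this
  have hunif : TendstoUniformlyOn g 0 atTop (Set.Icc 0 (t : ℝ)) :=
    Antitone.tendstoUniformlyOn_of_forall_tendsto isCompact_Icc (fun F => (hcont F).continuousOn)
      (fun s _ => hanti s) continuousOn_const fun s _ => by
        have := (SigmaWeakTendsto.map S hsw s.toNNReal).inner x x
        rw [_root_.map_zero, _root_.zero_apply, inner_zero_right] at this
        exact (Complex.continuous_re.tendsto _).comp this
  rw [Metric.tendsto_nhds]
  intro ε hε
  filter_upwards [Metric.tendstoUniformlyOn_iff.1 hunif (ε / (t + 1)) (by positivity)] with F hF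
  have hint : (S.integralFunctional x t (1 - e.partialProj F)).re = ∫ s in (0 : ℝ)..t, g F s := by
    rw [integralFunctional_apply]
    exact (Complex.reCLM.intervalIntegral_comp_comm
      ((S.continuous_inner _ x x).intervalIntegrable _ _)).symm
  rw [hint, dist_zero_right]
  calc ‖∫ s in (0 : ℝ)..t, g F s‖ ≤ ε / (t + 1) * |(t : ℝ) - 0| := by
        refine intervalIntegral.norm_integral_le_of_norm_le_const fun s hs => ?_
        rw [Set.uIoc_of_le t.coe_nonneg] at hs
        simpa [dist_eq_norm] using (hF s (Set.Ioc_subset_Icc_self hs)).le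
    _ = ε * (t / (t + 1)) := by
        rw [sub_zero, abs_of_nonneg t.coe_nonneg]
        ring
    _ < ε * 1 := by
        gcongr
        rw [div_lt_one (by positivity)]
        linarith
    _ = ε := mul_one ε

theorem tendsto_integralFunctional {ι : Type*} {l : Filter ι} {f : ι → H →L[ℂ] H}
    {B : H →L[ℂ] H} (hf : SigmaWeakTendsto f l B) (x : H) (t : ℝ≥0) :
    Tendsto (fun i => S.integralFunctional x t (f i)) l (𝓝 (S.integralFunctional x t B)) := by
  obtain ⟨w, hw, h⟩ := S.exists_integralFunctional_eq_tsum x t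
  simp only [h]
  exact sigmaWeakTendsto_iff.1 hf w w hw hw

end QuantumMarkovSemigroup

theorem tendsto_inv_mul_integral {g : ℝ → ℂ} (hg : Continuous g) (a : ℝ) :
    Tendsto (fun τ : ℝ≥0 => ((τ : ℝ) : ℂ)⁻¹ * ∫ s in a..(a + τ), g s) (𝓝[>] 0) (𝓝 (g a)) := by
  have h1 : HasDerivWithinAt (fun u => ∫ s in a..u, g s) (g a) (Set.Ioi a) a :=
    (hg.integral_hasStrictDerivAt a a).hasDerivAt.hasDerivWithinAt
  rw [hasDerivWithinAt_iff_tendsto_slope' (by simp)] at h1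
  have h2 : Tendsto (fun τ : ℝ≥0 => a + (τ : ℝ)) (𝓝[>] 0) (𝓝[>] a) := by
    refine tendsto_nhdsWithin_of_tendsto_nhds_of_eventually_within _ ?_ ?_
    · have : Continuous fun τ : ℝ≥0 => a + (τ : ℝ) := by fun_prop
      simpa using (this.tendsto 0).mono_left nhdsWithin_le_nhds
    · filter_upwards [self_mem_nhdsWithin] with τ hτ
      simpa using hτ
  refine (h1.comp h2).congr fun τ => ?_
  simp [slope_def_module]

/-! ### The generator: closability, Lipschitz orbits, conditional complete positivity. -/

namespace QuantumMarkovSemigroup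

open InnerProductSpace MeasureTheory ComplexOrder

variable {H : Type u} [NormedAddCommGroup H] [InnerProductSpace ℂ H] [CompleteSpace H]
  {S : QuantumMarkovSemigroup H}

theorem tendsto_inv_mul_integralFunctional (x : H) (B : H →L[ℂ] H) :
    Tendsto (fun τ : ℝ≥0 => ((τ : ℝ) : ℂ)⁻¹ * S.integralFunctional x τ B) (𝓝[>] 0)
      (𝓝 ⟪x, B x⟫_ℂ) := by
  simpa [integralFunctional_apply, S.map_zero] using
    tendsto_inv_mul_integral (S.continuous_inner B x x) 0

theorem IsDerivAtZero.inner_sub_eq_integralFunctional {A B : H →L[ℂ] H}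
    (h : S.IsDerivAtZero A B) (x : H) (t : ℝ≥0) :
    ⟪x, (S.toFun t A - A) x⟫_ℂ = S.integralFunctional x t B :=
  h.inner_sub_eq_integral x x t

/-- The generator is closable for the σ-weak topology. -/
theorem eq_zero_of_isDerivAtZero {ι : Type*} {l : Filter ι} [l.NeBot] {f g : ι → H →L[ℂ] H}
    {B : H →L[ℂ] H} (h : ∀ i, S.IsDerivAtZero (f i) (g i)) (hf : SigmaWeakTendsto f l 0)
    (hg : SigmaWeakTendsto g l B) : B = 0 := by
  -- Normality lets the limit pass through `∫₀ᵗ ⟨x, T_s g_i x⟩ ds = ⟨x, (T_t f_i - f_i) x⟩`;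
  -- dividing by `t → 0` then recovers `⟨x, B x⟩`.
  have h0 : ∀ x t, S.integralFunctional x t B = 0 := fun x t => by
    refine tendsto_nhds_unique (S.tendsto_integralFunctional hg x t) ?_
    simp only [← (h _).inner_sub_eq_integralFunctional]
    simpa [inner_sub_right] using ((SigmaWeakTendsto.map S hf t).inner x x).sub (hf.inner x x)
  refine ext_inner_self fun x => ?_
  have := tendsto_inv_mul_integralFunctional (S := S) x B
  simp only [h0, mul_zero] at this
  simpa using (tendsto_nhds_unique this tendsto_const_nhds)

theorem norm_inv_smul_le {A : H →L[ℂ] H} {C : ℝ} (hC : ∀ t, ‖S.toFun t A - A‖ ≤ C * t) :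
    ∀ᶠ t : ℝ≥0 in 𝓝[>] 0, ‖((t : ℝ) : ℂ)⁻¹ • (S.toFun t A - A)‖ ≤ C := by
  filter_upwards [self_mem_nhdsWithin] with t ht
  have ht' : 0 < (t : ℝ) := ht
  rw [norm_smul, norm_inv, Complex.norm_real, Real.norm_of_nonneg ht'.le, inv_mul_le_iff₀ ht',
    mul_comm]
  exact hC t

/-- Shifting the time variable telescopes the integral into averages over `[t, t+τ]` and `[0, τ]`.
-/
theorem tendsto_integralFunctional_inv_smul (A : H →L[ℂ] H) (x : H) (t : ℝ≥0) :
    Tendsto (fun τ : ℝ≥0 => S.integralFunctional x t (((τ : ℝ) : ℂ)⁻¹ • (S.toFun τ A - A)))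
      (𝓝[>] 0) (𝓝 ⟪x, (S.toFun t A - A) x⟫_ℂ) := by
  have hg := S.continuous_inner A x x
  have h1 := (tendsto_inv_mul_integral hg t).sub (tendsto_inv_mul_integral hg 0)
  have h2 : ⟪x, (S.toFun t A - A) x⟫_ℂ
      = ⟪x, S.toFun (t : ℝ).toNNReal A x⟫_ℂ - ⟪x, S.toFun (0 : ℝ).toNNReal A x⟫_ℂ := by
    simp [S.map_zero]
  rw [h2]
  refine h1.congr fun τ => ?_
  have hint := fun a b => hg.intervalIntegrable (μ := volume) a b
  rw [← mul_sub, _root_.map_smul, _root_.map_sub, smul_eq_mul, integralFunctional_apply,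
    integralFunctional_apply]
  congr 1
  have h3 : ∫ s in (0 : ℝ)..t, ⟪x, S.toFun s.toNNReal (S.toFun τ A) x⟫_ℂ
      = ∫ s in (τ : ℝ)..(t + τ), ⟪x, S.toFun s.toNNReal A x⟫_ℂ := by
    have h4 := intervalIntegral.integral_comp_add_right (a := 0) (b := t)
      (fun s : ℝ => ⟪x, S.toFun s.toNNReal A x⟫_ℂ) (τ : ℝ)
    rw [zero_add] at h4
    rw [← h4]
    refine intervalIntegral.integral_congr fun s hs => ?_
    rw [Set.uIcc_of_le t.coe_nonneg] at hs
    simp only [Real.toNNReal_add hs.1 τ.coe_nonneg, S.map_add, Real.toNNReal_coe]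
  rw [h3, zero_add, ← intervalIntegral.integral_interval_sub_interval_comm (hint _ _) (hint _ _)
    (hint _ _), intervalIntegral.integral_symm 0 (t : ℝ),
    intervalIntegral.integral_symm (τ : ℝ) (t + τ)]
  ring

/-- An operator whose orbit is Lipschitz at `0` belongs to the domain of the generator. -/
theorem mem_domain_of_norm_sub_le {A : H →L[ℂ] H} {C : ℝ}
    (hC : ∀ t, ‖S.toFun t A - A‖ ≤ C * t) : A ∈ S.domain := by
  have hbd := norm_inv_smul_le hC
  let U := Ultrafilter.of (𝓝[>] (0 : ℝ≥0))
  have hU : (U : Filter ℝ≥0) ≤ 𝓝[>] 0 := Ultrafilter.of_le _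
  -- A limit point `B` of the bounded quotients, taken along an ultrafilter, already satisfies `T_t
  -- A - A = ∫₀ᵗ T_s B ds` in quadratic form; this identity forces convergence along the full
  -- filter.
  obtain ⟨B, hB⟩ := exists_tendsto_inner_of_bounded U _ (hbd.filter_mono hU)
  have hBs := sigmaWeakTendsto_of_bounded (hbd.filter_mono hU) fun x => hB x x
  refine ⟨B, sigmaWeakTendsto_of_bounded hbd fun x => ?_⟩
  refine (tendsto_inv_mul_integralFunctional (S := S) x B).congr fun t => ?_
  rw [_root_.smul_apply, inner_smul_right, tendsto_nhds_unique
    (S.tendsto_integralFunctional hBs x t) ((tendsto_integralFunctional_inv_smul A x t).mono_left hU)]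

theorem IsDerivAtZero.generator_eq {A B : H →L[ℂ] H} (h : S.IsDerivAtZero A B) :
    S.generator A = B := by
  have hex : ∃ B, S.IsDerivAtZero A B := ⟨B, h⟩
  rw [generator, dif_pos hex]
  exact SigmaWeakTendsto.unique hex.choose_spec h

theorem isDerivAtZero_generator {A : H →L[ℂ] H} (h : A ∈ S.domain) :
    S.IsDerivAtZero A (S.generator A) := by
  obtain ⟨B, hB⟩ := h
  rwa [hB.generator_eq]

theorem IsDerivAtZero.add {A A' B B' : H →L[ℂ] H} (h : S.IsDerivAtZero A B)
    (h' : S.IsDerivAtZero A' B') : S.IsDerivAtZero (A + A') (B + B') := by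
  refine (SigmaWeakTendsto.add h h').congr fun t => ?_
  rw [_root_.map_add, ← smul_add]
  congr 1
  abel

theorem IsDerivAtZero.smul {A B : H →L[ℂ] H} (c : ℂ) (h : S.IsDerivAtZero A B) :
    S.IsDerivAtZero (c • A) (c • B) := by
  have h1 := SigmaWeakTendsto.sandwich h (c • ContinuousLinearMap.id ℂ H)
    (ContinuousLinearMap.id ℂ H)
  have h2 : c • B = (c • ContinuousLinearMap.id ℂ H) ∘L B ∘L ContinuousLinearMap.id ℂ H := by
    ext x
    simp
  rw [h2]
  refine h1.congr fun t => ?_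
  ext x
  simp only [_root_.map_smul, ContinuousLinearMap.comp_id, ContinuousLinearMap.smul_comp,
    ContinuousLinearMap.id_comp]
  rw [← smul_sub, smul_comm]

theorem IsDerivAtZero.star {A B : H →L[ℂ] H} (h : S.IsDerivAtZero A B) :
    S.IsDerivAtZero (star A) (star B) := by
  have hst : ∀ t : ℝ≥0, ((t : ℝ) : ℂ)⁻¹ • (S.toFun t (Star.star A) - Star.star A)
      = Star.star (((t : ℝ) : ℂ)⁻¹ • (S.toFun t A - A)) := fun t => by
    simp [S.map_star]
  refine sigmaWeakTendsto_of_bounded (C := ‖B‖) (norm_inv_smul_le fun t => ?_) fun x => ?_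
  · rw [S.map_star, ← star_sub, norm_star]
    exact h.norm_sub_le t
  · have hadj : ∀ C : H →L[ℂ] H, ⟪x, Star.star C x⟫_ℂ = ⟪C x, x⟫_ℂ := fun C => by
      rw [ContinuousLinearMap.star_eq_adjoint, ContinuousLinearMap.adjoint_inner_right]
    simp only [hst, hadj]
    have := (Complex.continuous_conj.tendsto _).comp (SigmaWeakTendsto.inner h x x)
    simpa only [Function.comp_def, inner_conj_symm] using this

theorem isDerivAtZero_one : S.IsDerivAtZero 1 0 := by
  refine sigmaWeakTendsto_of_bounded (C := 0) (Eventually.of_forall fun t => ?_) fun x => ?_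
  · simp [S.map_one]
  · simp [S.map_one]

/-- The generator is conditionally completely positive. -/
theorem re_sum_inner_generator_nonneg {ι : Type*} [Fintype ι] (b : ι → H →L[ℂ] H) (x : ι → H)
    (hb : ∀ i j, star (b i) * b j ∈ S.domain) (hx : ∑ i, b i (x i) = 0) :
    0 ≤ (∑ i, ∑ j, ⟪x i, S.generator (star (b i) * b j) (x j)⟫_ℂ).re := by
  have h1 : Tendsto (fun t : ℝ≥0 => (∑ i, ∑ j, ⟪x i, (((t : ℝ) : ℂ)⁻¹ •
      (S.toFun t (star (b i) * b j) - star (b i) * b j)) (x j)⟫_ℂ).re) (𝓝[>] 0)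
      (𝓝 (∑ i, ∑ j, ⟪x i, S.generator (star (b i) * b j) (x j)⟫_ℂ).re) :=
    (Complex.continuous_re.tendsto _).comp (tendsto_finsetSum _ fun i _ =>
      tendsto_finsetSum _ fun j _ => SigmaWeakTendsto.inner (isDerivAtZero_generator (hb i j)) _ _)
  refine ge_of_tendsto h1 (Eventually.of_forall fun t => ?_)
  have h2 : ∑ i, ∑ j, ⟪x i, (star (b i) * b j) (x j)⟫_ℂ = 0 := by
    simp only [mul_apply_eq_comp, ContinuousLinearMap.star_eq_adjoint,
      ContinuousLinearMap.adjoint_inner_right, ← inner_sum, ← sum_inner, hx, inner_zero_left]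
  simp only [_root_.smul_apply, _root_.sub_apply, inner_smul_right, inner_sub_right, ← Finset.mul_sum,
    Finset.sum_sub_distrib, h2, sub_zero]
  rw [← Complex.ofReal_inv, Complex.re_ofReal_mul]
  exact mul_nonneg (inv_nonneg.2 t.coe_nonneg) ((S.toFun t).re_sum_inner_nonneg b x)

end QuantumMarkovSemigroup

/-! ### The domain algebra lies in the domain. -/

namespace QuantumMarkovSemigroup

variable {H : Type u} [NormedAddCommGroup H] [InnerProductSpace ℂ H] [CompleteSpace H]
  (S : QuantumMarkovSemigroup H)

/-- The defect `T_t(A⋆A) - T_t(A)⋆T_t(A)` of multiplicativity. -/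
noncomputable def defect (t : ℝ≥0) (A : H →L[ℂ] H) : H →L[ℂ] H :=
  S.toFun t (star A * A) - star (S.toFun t A) * S.toFun t A

theorem exists_defect_representation (t : ℝ≥0) :
    ∃ (K : Type u) (_ : NormedAddCommGroup K) (_ : InnerProductSpace ℂ K) (_ : CompleteSpace K)
      (X : (H →L[ℂ] H) → H →L[ℂ] K), (∀ A B, X (A + B) = X A + X B) ∧
      (∀ A B, (X A).adjoint ∘L X B = S.toFun t (star A * B) - star (S.toFun t A) * S.toFun t B) ∧
      ∀ A B, ‖X (A * B)‖ ≤ 2 * ‖A‖ * ‖X B‖ + ‖X A‖ * ‖B‖ := by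
  obtain ⟨K, _, _, _, V, π, hV1, hVV, hV, hπ⟩ := S.exists_dilation t
  have hVV' : ∀ x, V.adjoint (V x) = x := fun x => DFunLike.congr_fun hVV x
  have hV' : ∀ A x, V.adjoint (π A (V x)) = S.toFun t A x := fun A x => by
    rw [hV]
    rfl
  -- Since `T_t(A) = V* π(A) V`, this is `X A = (1 - VV*) π(A) V`, whose Gram operators are the
  -- defects.
  refine ⟨K, inferInstance, inferInstance, inferInstance, fun A => π A ∘L V - V ∘L S.toFun t A,
    fun A B => ?_, fun A B => ?_, fun A B => ?_⟩
  · ext x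
    simp only [_root_.map_add, _root_.sub_apply, _root_.add_apply, ContinuousLinearMap.comp_apply]
    abel
  · ext x
    refine ext_inner_left ℂ fun y => ?_
    rw [ContinuousLinearMap.comp_apply, ContinuousLinearMap.adjoint_inner_right]
    simp only [_root_.sub_apply, ContinuousLinearMap.comp_apply, inner_sub_left, inner_sub_right,
      mul_apply_eq_comp, ContinuousLinearMap.star_eq_adjoint,
      ContinuousLinearMap.adjoint_inner_right]
    simp only [← ContinuousLinearMap.adjoint_inner_right V, hVV', hV']
    have h1 : ⟪π A (V y), π B (V x)⟫_ℂ = ⟪y, S.toFun t (A.adjoint * B) x⟫_ℂ := by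
      rw [← hV', ContinuousLinearMap.adjoint_inner_right, _root_.map_mul,
        ← ContinuousLinearMap.star_eq_adjoint, StarHomClass.map_star, mul_apply_eq_comp,
        ContinuousLinearMap.star_eq_adjoint, ContinuousLinearMap.adjoint_inner_right]
    have h2 : ⟪π A (V y), V (S.toFun t B x)⟫_ℂ = ⟪S.toFun t A y, S.toFun t B x⟫_ℂ := by
      rw [← ContinuousLinearMap.adjoint_inner_left, hV']
    rw [h1, h2]
    ring
  · have h1 : π (A * B) ∘L V - V ∘L S.toFun t (A * B)
        = (π A ∘L (π B ∘L V - V ∘L S.toFun t B)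
            - V ∘L V.adjoint ∘L π A ∘L (π B ∘L V - V ∘L S.toFun t B))
          + (π A ∘L V - V ∘L S.toFun t A) ∘L S.toFun t B := by
      ext x
      simp only [_root_.map_mul, _root_.sub_apply, _root_.add_apply,
        ContinuousLinearMap.comp_apply, mul_apply_eq_comp, _root_.map_sub, hV']
      rw [← hV' (A * B), _root_.map_mul, mul_apply_eq_comp]
      abel
    beta_reduce
    rw [h1]
    set Y := π B ∘L V - V ∘L S.toFun t B
    set Z := π A ∘L V - V ∘L S.toFun t A
    have h2 : ‖π A ∘L Y‖ ≤ ‖A‖ * ‖Y‖ :=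
      (ContinuousLinearMap.opNorm_comp_le _ _).trans (by gcongr; exact hπ A)
    have h3 : ‖V ∘L V.adjoint ∘L π A ∘L Y‖ ≤ ‖A‖ * ‖Y‖ := by
      calc ‖V ∘L V.adjoint ∘L π A ∘L Y‖ ≤ ‖V‖ * (‖V.adjoint‖ * ‖π A ∘L Y‖) :=
            (ContinuousLinearMap.opNorm_comp_le _ _).trans (mul_le_mul_of_nonneg_left
              (ContinuousLinearMap.opNorm_comp_le _ _) (norm_nonneg _))
        _ ≤ 1 * (1 * (‖A‖ * ‖Y‖)) := by
            gcongr
            rwa [LinearIsometryEquiv.norm_map]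
        _ = _ := by ring
    have h4 : ‖Z ∘L S.toFun t B‖ ≤ ‖Z‖ * ‖B‖ :=
      (ContinuousLinearMap.opNorm_comp_le _ _).trans (by gcongr; exact S.norm_map_le t B)
    calc _ ≤ (‖π A ∘L Y‖ + ‖V ∘L V.adjoint ∘L π A ∘L Y‖) + ‖Z ∘L S.toFun t B‖ :=
          (norm_add_le _ _).trans (by gcongr; exact norm_sub_le _ _)
      _ ≤ _ := by linarith

/-- The defect of multiplicativity at `A` is at most linear in time. -/
def HasLinearDefect (A : H →L[ℂ] H) : Prop :=
  ∃ C : ℝ, ∀ t : ℝ≥0, ‖S.defect t A‖ ≤ C * t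

variable {S}

/-- The norm of the defect is `‖X A‖²` with `X` additive, so the triangle inequality for `X`
applies. -/
theorem HasLinearDefect.add {A B : H →L[ℂ] H} (hA : S.HasLinearDefect A)
    (hB : S.HasLinearDefect B) : S.HasLinearDefect (A + B) := by
  obtain ⟨C, hC⟩ := hA
  obtain ⟨C', hC'⟩ := hB
  refine ⟨2 * (C + C'), fun t => ?_⟩
  obtain ⟨K, _, _, _, X, hadd, hX, -⟩ := S.exists_defect_representation t
  have hn : ∀ A, ‖S.defect t A‖ = ‖X A‖ ^ 2 := fun A => by
    rw [defect, ← hX, ContinuousLinearMap.norm_adjoint_comp_self, sq]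
  have h1 := hC t
  have h2 := hC' t
  rw [hn] at *
  rw [hadd]
  have h3 : ‖X A + X B‖ ^ 2 ≤ (‖X A‖ + ‖X B‖) ^ 2 := by
    gcongr
    exact norm_add_le _ _
  nlinarith [sq_nonneg (‖X A‖ - ‖X B‖)]

theorem HasLinearDefect.mul {A B : H →L[ℂ] H} (hA : S.HasLinearDefect A)
    (hB : S.HasLinearDefect B) : S.HasLinearDefect (A * B) := by
  obtain ⟨C, hC⟩ := hA
  obtain ⟨C', hC'⟩ := hB
  refine ⟨2 * ((2 * ‖A‖) ^ 2 * C' + ‖B‖ ^ 2 * C), fun t => ?_⟩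
  obtain ⟨K, _, _, _, X, -, hX, hmul⟩ := S.exists_defect_representation t
  have hn : ∀ A, ‖S.defect t A‖ = ‖X A‖ ^ 2 := fun A => by
    rw [defect, ← hX, ContinuousLinearMap.norm_adjoint_comp_self, sq]
  have h1 := hC t
  have h2 := hC' t
  rw [hn] at *
  have h3 : ‖X (A * B)‖ ^ 2 ≤ (2 * ‖A‖ * ‖X B‖ + ‖X A‖ * ‖B‖) ^ 2 := by
    gcongr
    exact hmul A B
  calc ‖X (A * B)‖ ^ 2 ≤ (2 * ‖A‖ * ‖X B‖ + ‖X A‖ * ‖B‖) ^ 2 := h3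
    _ ≤ 2 * ((2 * ‖A‖) ^ 2 * ‖X B‖ ^ 2 + ‖B‖ ^ 2 * ‖X A‖ ^ 2) := by
        nlinarith [sq_nonneg (2 * ‖A‖ * ‖X B‖ - ‖X A‖ * ‖B‖)]
    _ ≤ 2 * ((2 * ‖A‖) ^ 2 * (C' * t) + ‖B‖ ^ 2 * (C * t)) := by gcongr
    _ = _ := by ring

theorem norm_map_mul_map_sub_le {A B A' B' : H →L[ℂ] H} (hA : S.IsDerivAtZero A A')
    (hB : S.IsDerivAtZero B B') (t : ℝ≥0) :
    ‖S.toFun t A * S.toFun t B - A * B‖ ≤ (‖A'‖ * ‖B‖ + ‖A‖ * ‖B'‖) * t := by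
  have h1 : S.toFun t A * S.toFun t B - A * B
      = (S.toFun t A - A) * S.toFun t B + A * (S.toFun t B - B) := by noncomm_ring
  rw [h1]
  calc _ ≤ ‖S.toFun t A - A‖ * ‖S.toFun t B‖ + ‖A‖ * ‖S.toFun t B - B‖ :=
        (norm_add_le _ _).trans (add_le_add (norm_mul_le _ _) (norm_mul_le _ _))
    _ ≤ (‖A'‖ * t) * ‖B‖ + ‖A‖ * (‖B'‖ * t) := by
        gcongr
        · exact hA.norm_sub_le t
        · exact S.norm_map_le t B
        · exact hB.norm_sub_le t
    _ = _ := by ring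

theorem hasLinearDefect_of_mem_domain {A : H →L[ℂ] H} (hA : A ∈ S.domain)
    (hAA : star A * A ∈ S.domain) : S.HasLinearDefect A := by
  obtain ⟨A', hA'⟩ := hA
  obtain ⟨B', hB'⟩ := hAA
  refine ⟨‖B'‖ + (‖star A'‖ * ‖A‖ + ‖star A‖ * ‖A'‖), fun t => ?_⟩
  have h1 : S.defect t A = (S.toFun t (star A * A) - star A * A)
      - (S.toFun t (star A) * S.toFun t A - star A * A) := by
    rw [defect, S.map_star]
    abel
  rw [h1, add_mul]
  exact (norm_sub_le _ _).trans
    (add_le_add (hB'.norm_sub_le t) (norm_map_mul_map_sub_le hA'.star hA' t))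

/-- `T_t(AB) - T_t(A) T_t(B) = X(A*)* X(B)` is `O(√t · √t)`, so the orbit of `AB` is Lipschitz at
`0`. Hence linear defect is needed for `A*` and for `B`. -/
theorem mul_mem_domain {A B : H →L[ℂ] H} (hA : A ∈ S.domain) (hB : B ∈ S.domain)
    (hA' : S.HasLinearDefect (star A)) (hB' : S.HasLinearDefect B) : A * B ∈ S.domain := by
  obtain ⟨A', hAd⟩ := hA
  obtain ⟨B', hBd⟩ := hB
  obtain ⟨C, hC⟩ := hA'
  obtain ⟨C', hC'⟩ := hB'
  refine mem_domain_of_norm_sub_le (C := (C + C') + (‖A'‖ * ‖B‖ + ‖A‖ * ‖B'‖)) fun t => ?_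
  obtain ⟨K, _, _, _, X, -, hX, -⟩ := S.exists_defect_representation t
  have hn : ∀ A, ‖S.defect t A‖ = ‖X A‖ ^ 2 := fun A => by
    rw [defect, ← hX, ContinuousLinearMap.norm_adjoint_comp_self, sq]
  have h1 := hC t
  have h2 := hC' t
  rw [hn] at h1 h2
  have h3 : S.toFun t (A * B) - A * B = (X (star A)).adjoint ∘L X B
      + (S.toFun t A * S.toFun t B - A * B) := by
    rw [hX, S.map_star, star_star, star_star]
    abel
  have h4 : ‖(X (star A)).adjoint ∘L X B‖ ≤ ‖X (star A)‖ * ‖X B‖ := by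
    refine (ContinuousLinearMap.opNorm_comp_le _ _).trans_eq ?_
    rw [LinearIsometryEquiv.norm_map]
  rw [h3, add_mul]
  refine (norm_add_le _ _).trans (add_le_add (h4.trans ?_) (norm_map_mul_map_sub_le hAd hBd t))
  nlinarith [sq_nonneg (‖X (star A)‖ - ‖X B‖), sq_nonneg ‖X (star A)‖, sq_nonneg ‖X B‖]

theorem algebraMap_mem_domain (c : ℂ) : algebraMap ℂ (H →L[ℂ] H) c ∈ S.domain :=
  ⟨c • 0, by
    rw [Algebra.algebraMap_eq_smul_one]
    exact isDerivAtZero_one.smul c⟩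

theorem hasLinearDefect_algebraMap (c : ℂ) : S.HasLinearDefect (algebraMap ℂ (H →L[ℂ] H) c) :=
  hasLinearDefect_of_mem_domain (algebraMap_mem_domain c) (by
    rw [← algebraMap_star_comm, ← _root_.map_mul]
    exact algebraMap_mem_domain _)

variable (S) in
/-- The operators in the domain of the generator at which the semigroup is multiplicative up to a
linear error form a `*`-algebra. -/
noncomputable def linearDefectAlgebra : StarSubalgebra ℂ (H →L[ℂ] H) where
  carrier := {A | A ∈ S.domain ∧ S.HasLinearDefect A ∧ S.HasLinearDefect (star A)}
  mul_mem' := fun {A B} hA hB => ⟨mul_mem_domain hA.1 hB.1 hA.2.2 hB.2.1, hA.2.1.mul hB.2.1, by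
    rw [star_mul]
    exact hB.2.2.mul hA.2.2⟩
  add_mem' := fun {A B} hA hB => ⟨by
    obtain ⟨A', hA'⟩ := hA.1
    obtain ⟨B', hB'⟩ := hB.1
    exact ⟨_, hA'.add hB'⟩, hA.2.1.add hB.2.1, by
    rw [star_add]
    exact hA.2.2.add hB.2.2⟩
  algebraMap_mem' := fun c => ⟨algebraMap_mem_domain c, hasLinearDefect_algebraMap c, by
    rw [← algebraMap_star_comm]
    exact hasLinearDefect_algebraMap _⟩
  star_mem' := fun {A} hA => ⟨by
    obtain ⟨A', hA'⟩ := hA.1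
    exact ⟨_, hA'.star⟩, hA.2.2, by
    rw [star_star]
    exact hA.2.1⟩

/-- The domain algebra is contained in the domain. -/
theorem mem_domain_of_mem_domainAlgebra {A : H →L[ℂ] H} (hA : A ∈ S.domainAlgebra) :
    A ∈ S.domain := by
  -- A subalgebra inside the domain contains `B* B` and `B B*` along with `B`, which gives both
  -- linear defects.
  have h1 : S.domainAlgebra ≤ S.linearDefectAlgebra := by
    refine sSup_le fun M hM B hB => ?_
    exact ⟨hM hB, hasLinearDefect_of_mem_domain (hM hB) (hM (mul_mem (star_mem hB) hB)),
      hasLinearDefect_of_mem_domain (hM (star_mem hB)) (hM (mul_mem (star_mem (star_mem hB))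
        (star_mem hB)))⟩
  exact (h1 hA).1

end QuantumMarkovSemigroup

/-! ### Associate vectors and the operator `T - |Th⟩⟨Th|`. -/

section AssociateVector

open InnerProductSpace

variable {H : Type*} [NormedAddCommGroup H] [InnerProductSpace ℂ H]

/-- Every `‖k s‖²` equals `t`, so `h = t^(-1/2) ∑ k' s` and `⟨h, Th⟩ = t⁻¹ ∑ t' s`. -/
theorem IsAssociateVector.inner_map_self {T : H →L[ℂ] H} {h : H} (hh : IsAssociateVector T h)
    (hT : T ≠ 0) : ⟪h, T h⟫_ℂ = 1 := by
  obtain ⟨m, k', t', k, hk', ht', hTk, hk, hhk⟩ := hh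
  set t := ∑ r, t' r with ht
  have hm : Nonempty (Fin m) := by
    by_contra hm
    rw [not_nonempty_iff] at hm
    exact hT (by rw [hTk]; simp)
  have htpos : 0 < t := Finset.sum_pos (fun i _ => ht' i) Finset.univ_nonempty
  have hkn : ∀ s, ((‖k s‖ ^ 2)⁻¹ : ℂ) • k s = ((t⁻¹ * √t : ℝ) : ℂ) • k' s := fun s => by
    have h1 : ‖k s‖ ^ 2 = t := by
      rw [hk, norm_smul, hk'.1 s, mul_one, Complex.norm_real, Real.norm_of_nonneg (Real.sqrt_nonneg _),
        Real.sq_sqrt htpos.le]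
    rw [← Complex.ofReal_pow, h1, hk s, smul_smul]
    push_cast
    rfl
  set a : ℝ := t⁻¹ * √t with ha
  have hha : h = ∑ s, (a : ℂ) • k' s := by
    rw [hhk]
    exact Finset.sum_congr rfl fun s _ => hkn s
  have hin : ∀ s, ⟪k' s, h⟫_ℂ = a := fun s => by
    rw [hha]
    exact hk'.inner_right_fintype (fun _ => (a : ℂ)) s
  have hin' : ∀ s, ⟪h, k' s⟫_ℂ = a := fun s => by
    rw [← inner_conj_symm, hin, Complex.conj_ofReal]
  have h2 : ⟪h, T h⟫_ℂ = ((∑ s, t' s * a * a : ℝ) : ℂ) := by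
    rw [hTk]
    simp only [_root_.sum_apply, _root_.smul_apply, rankOne_apply, inner_sum, inner_smul_right, hin,
      hin']
    push_cast
    exact Finset.sum_congr rfl fun s _ => by ring
  have h3 : ∑ s, t' s * a * a = 1 := by
    simp only [mul_assoc, ← Finset.sum_mul, ← ht]
    have h4 : a * a = t⁻¹ := by
      rw [ha, mul_mul_mul_comm, Real.mul_self_sqrt htpos.le]
      field_simp
    rw [h4, mul_inv_cancel₀ htpos.ne']
  rw [h2, h3, Complex.ofReal_one]

variable [CompleteSpace H]

/-- The operator `T - |Th⟩⟨Th|` is positive with `h` in its kernel. -/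
theorem ContinuousLinearMap.IsPositive.exists_sub_rankOne_eq {T : H →L[ℂ] H} (hT : T.IsPositive)
    {h : H} (hh : ⟪h, T h⟫_ℂ = 1) :
    ∃ b : H →L[ℂ] H, star b * b = T - rankOne ℂ (T h) (T h) ∧ b h = 0 := by
  obtain ⟨D, hD⟩ := CStarAlgebra.nonneg_iff_eq_star_mul_self.1
    ((ContinuousLinearMap.nonneg_iff_isPositive T).2 hT)
  have hTD : ∀ x y, ⟪x, T y⟫_ℂ = ⟪D x, D y⟫_ℂ := fun x y => by
    rw [hD, mul_apply_eq_comp, ContinuousLinearMap.star_eq_adjoint,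
      ContinuousLinearMap.adjoint_inner_right]
  have hDh : ‖D h‖ = 1 := by
    rw [hTD, inner_self_eq_norm_sq_to_K] at hh
    have h1 : ‖D h‖ ^ 2 = 1 := Complex.ofReal_injective (by
      rw [Complex.ofReal_pow, Complex.ofReal_one]
      exact hh)
    exact (pow_eq_one_iff_of_nonneg (norm_nonneg _) two_ne_zero).1 h1
  have hTD' : ∀ x, ⟪T h, x⟫_ℂ = ⟪D h, D x⟫_ℂ := fun x => by
    rw [← inner_conj_symm, hTD, inner_conj_symm]
  -- With `T = D* D` and `‖D h‖ = 1`, positivity is Cauchy–Schwarz for `D h` and `D x`, with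
  -- equality at `x = h`.
  have hin : ∀ x, ⟪x, (T - rankOne ℂ (T h) (T h)) x⟫_ℂ
      = ((‖D x‖ ^ 2 - ‖⟪D h, D x⟫_ℂ‖ ^ 2 : ℝ) : ℂ) := fun x => by
    rw [_root_.sub_apply, rankOne_apply, inner_sub_right, inner_smul_right, hTD x x, hTD x h, hTD',
      inner_self_eq_norm_sq_to_K, ← inner_conj_symm (D x) (D h), RCLike.mul_conj]
    push_cast
    rfl
  have hpos : 0 ≤ T - rankOne ℂ (T h) (T h) := by
    rw [ContinuousLinearMap.nonneg_iff_isPositive, ContinuousLinearMap.isPositive_iff_complex]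
    intro x
    rw [← inner_conj_symm, hin, Complex.conj_ofReal, RCLike.re_to_complex, Complex.ofReal_re]
    refine ⟨rfl, sub_nonneg.2 ?_⟩
    have := norm_inner_le_norm (𝕜 := ℂ) (D h) (D x)
    rw [hDh, one_mul] at this
    gcongr
  obtain ⟨b, hb⟩ := CStarAlgebra.nonneg_iff_eq_star_mul_self.1 hpos
  refine ⟨b, hb.symm, ?_⟩
  have h1 : ⟪b h, b h⟫_ℂ = ⟪h, (T - rankOne ℂ (T h) (T h)) h⟫_ℂ := by
    rw [hb, mul_apply_eq_comp, ContinuousLinearMap.star_eq_adjoint,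
      ContinuousLinearMap.adjoint_inner_right]
  rw [hin, inner_self_eq_norm_sq_to_K (D h), hDh] at h1
  exact inner_self_eq_zero.1 (h1.trans (by simp))

end AssociateVector

/-! ### Linearity of the generator, the comparison constant and the drift `G`. -/

namespace QuantumMarkovSemigroup

open InnerProductSpace

variable {H : Type u} [NormedAddCommGroup H] [InnerProductSpace ℂ H] [CompleteSpace H]
  {S : QuantumMarkovSemigroup H}

theorem generator_add {A B : H →L[ℂ] H} (hA : A ∈ S.domain) (hB : B ∈ S.domain) :
    S.generator (A + B) = S.generator A + S.generator B :=
  ((isDerivAtZero_generator hA).add (isDerivAtZero_generator hB)).generator_eq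

theorem generator_smul (c : ℂ) {A : H →L[ℂ] H} (hA : A ∈ S.domain) :
    S.generator (c • A) = c • S.generator A :=
  ((isDerivAtZero_generator hA).smul c).generator_eq

theorem smul_mem_domain (c : ℂ) {A : H →L[ℂ] H} (hA : A ∈ S.domain) : c • A ∈ S.domain :=
  ⟨_, (isDerivAtZero_generator hA).smul c⟩

theorem generator_star {A : H →L[ℂ] H} (hA : A ∈ S.domain) :
    S.generator (star A) = star (S.generator A) :=
  (isDerivAtZero_generator hA).star.generator_eq

theorem star_mem_domain {A : H →L[ℂ] H} (hA : A ∈ S.domain) : star A ∈ S.domain :=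
  ⟨_, (isDerivAtZero_generator hA).star⟩

theorem generator_neg {A : H →L[ℂ] H} (hA : A ∈ S.domain) :
    S.generator (-A) = -S.generator A := by
  rw [← neg_one_smul ℂ A, generator_smul _ hA, neg_one_smul]

theorem neg_mem_domain {A : H →L[ℂ] H} (hA : A ∈ S.domain) : -A ∈ S.domain := by
  rw [← neg_one_smul ℂ A]
  exact smul_mem_domain _ hA

/-- Conditional positivity for the single operator `b` with `b* b = T - |Th⟩⟨Th|` and `b h = 0`. -/
theorem re_inner_generator_rankOne_le {T : H →L[ℂ] H} (hT : T.IsPositive) (hT_dom : T ∈ S.domain)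
    {h : H} (hh : ⟪h, T h⟫_ℂ = 1) (hTh : rankOne ℂ (T h) (T h) ∈ S.domain) :
    (⟪h, S.generator (rankOne ℂ (T h) (T h)) h⟫_ℂ).re ≤ (⟪h, S.generator T h⟫_ℂ).re := by
  obtain ⟨b, hb, hbh⟩ := hT.exists_sub_rankOne_eq hh
  have hgen : S.generator (T - rankOne ℂ (T h) (T h))
      = S.generator T - S.generator (rankOne ℂ (T h) (T h)) := by
    rw [sub_eq_add_neg, generator_add hT_dom (neg_mem_domain hTh), generator_neg hTh, sub_eq_add_neg]
  have := S.re_sum_inner_generator_nonneg (fun _ : Unit => b) (fun _ => h) (fun _ _ => by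
    rw [hb]
    exact ⟨_, by
      rw [sub_eq_add_neg]
      exact (isDerivAtZero_generator hT_dom).add (isDerivAtZero_generator (neg_mem_domain hTh))⟩)
    (by simp [hbh])
  simp only [Finset.univ_unique, Finset.sum_singleton, hb, hgen, _root_.sub_apply, inner_sub_right,
    Complex.sub_re] at this
  linarith

variable (S) in
/-- The set `{x : |x⟩⟨y| ∈ 𝒜}` as a subspace. -/
noncomputable def rankOneSubmodule (y : H) : Submodule ℂ H where
  carrier := S.rankOneSpace y
  add_mem' := fun {a b} ha hb => by
    change rankOne ℂ (a + b) y ∈ S.domainAlgebra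
    rw [_root_.map_add, _root_.add_apply]
    exact add_mem ha hb
  zero_mem' := by
    change rankOne ℂ (0 : H) y ∈ S.domainAlgebra
    rw [_root_.map_zero, _root_.zero_apply]
    exact zero_mem _
  smul_mem' := fun c a ha => by
    change rankOne ℂ (c • a) y ∈ S.domainAlgebra
    rw [_root_.map_smul, _root_.smul_apply]
    exact SMulMemClass.smul_mem c ha

theorem mem_rankOneSubmodule {x y : H} :
    x ∈ S.rankOneSubmodule y ↔ rankOne ℂ x y ∈ S.domainAlgebra := Iff.rfl

theorem map_mem_rankOneSubmodule {A : H →L[ℂ] H} (hA : A ∈ S.domainAlgebra) {x y : H}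
    (hx : x ∈ S.rankOneSubmodule y) : A x ∈ S.rankOneSubmodule y := by
  rw [mem_rankOneSubmodule, ← comp_rankOne]
  exact mul_mem hA hx

/-- The formula is linear and bounded on the dense subspace `U`, so it extends by continuity. -/
theorem exists_drift {y h : H} (hdense : Dense (S.rankOneSpace y)) (c : ℂ)
    {C : ℝ} (hC : ∀ x ∈ S.rankOneSpace y, ‖S.generator (rankOne ℂ x y) h‖ ≤ C * ‖x‖) :
    ∃ G : H →L[ℂ] H, ∀ x ∈ S.rankOneSpace y, G x = S.generator (rankOne ℂ x y) h - c • x := by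
  let g : S.rankOneSubmodule y →ₗ[ℂ] H :=
    { toFun := fun x => S.generator (rankOne ℂ (x : H) y) h - c • (x : H)
      map_add' := fun a b => by
        simp only [Submodule.coe_add, _root_.map_add, _root_.add_apply, smul_add]
        rw [generator_add (mem_domain_of_mem_domainAlgebra a.2)
          (mem_domain_of_mem_domainAlgebra b.2), _root_.add_apply]
        abel
      map_smul' := fun r a => by
        simp only [Submodule.coe_smul, _root_.map_smul, _root_.smul_apply, RingHom.id_apply]
        rw [generator_smul r (mem_domain_of_mem_domainAlgebra a.2), _root_.smul_apply, smul_sub,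
          smul_comm c r] }
  have hd : DenseRange (S.rankOneSubmodule y).subtype := by
    change Dense (Set.range Subtype.val)
    rw [Subtype.range_coe]
    exact hdense
  refine ⟨g.extendOfNorm (S.rankOneSubmodule y).subtype, fun x hx => ?_⟩
  exact LinearMap.extendOfNorm_eq (f := g) hd ⟨C + ‖c‖, fun a => by
    change ‖S.generator (rankOne ℂ (a : H) y) h - c • (a : H)‖ ≤ (C + ‖c‖) * ‖(a : H)‖
    rw [add_mul, ← norm_smul]
    exact (norm_sub_le _ _).trans (by gcongr; exact hC a a.2)⟩ ⟨x, hx⟩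

end QuantumMarkovSemigroup

/-! ### Positivity of the dissipative part, the dilation and its closability. -/

namespace QuantumMarkovSemigroup

open InnerProductSpace

variable {H : Type u} [NormedAddCommGroup H] [InnerProductSpace ℂ H] [CompleteSpace H]
  {S : QuantumMarkovSemigroup H}

variable (S) in
/-- The part `A ↦ L(A) - G A - A G⋆` of the generator on the domain algebra. -/
noncomputable def dissipation (G : H →L[ℂ] H) : S.domainAlgebra →ₗ[ℂ] (H →L[ℂ] H) where
  toFun A := S.generator A - G ∘L (A : H →L[ℂ] H) - (A : H →L[ℂ] H) ∘L G.adjoint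
  map_add' A B := by
    rw [show ((A + B : S.domainAlgebra) : H →L[ℂ] H) = A + B from rfl, generator_add (mem_domain_of_mem_domainAlgebra A.2)
      (mem_domain_of_mem_domainAlgebra B.2), ContinuousLinearMap.comp_add,
      ContinuousLinearMap.add_comp]
    abel
  map_smul' r A := by
    rw [show ((r • A : S.domainAlgebra) : H →L[ℂ] H) = r • (A : H →L[ℂ] H) from rfl]
    simp only [ContinuousLinearMap.comp_smul, RingHom.id_apply,
      ContinuousLinearMap.smul_comp, generator_smul r (mem_domain_of_mem_domainAlgebra A.2), smul_sub]

theorem dissipation_apply (G : H →L[ℂ] H) (A : S.domainAlgebra) :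
    S.dissipation G A
      = S.generator A - G ∘L (A : H →L[ℂ] H) - (A : H →L[ℂ] H) ∘L G.adjoint := rfl

theorem dissipation_star (G : H →L[ℂ] H) (A : S.domainAlgebra) :
    S.dissipation G (star A) = star (S.dissipation G A) := by
  rw [dissipation_apply, dissipation_apply, StarMemClass.coe_star,
    generator_star (mem_domain_of_mem_domainAlgebra A.2)]
  simp only [star_sub, ContinuousLinearMap.star_eq_adjoint, ContinuousLinearMap.adjoint_comp,
    ContinuousLinearMap.adjoint_adjoint]
  abel

theorem re_sum_inner_dissipation_nonneg {y h : H} (hyh : ⟪y, h⟫_ℂ = 1) {c : ℝ}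
    (hy : rankOne ℂ y y ∈ S.domain) (hc : (⟪h, S.generator (rankOne ℂ y y) h⟫_ℂ).re ≤ c)
    {G : H →L[ℂ] H} (hG : ∀ x ∈ S.rankOneSpace y,
      G x = S.generator (rankOne ℂ x y) h - ((1 / 2 : ℂ) * c) • x)
    {ι : Type*} [Fintype ι] (b : ι → H →L[ℂ] H) (hb : ∀ i j, star (b i) * b j ∈ S.domainAlgebra)
    (x : ι → H) (hx : ∀ i, x i ∈ S.rankOneSpace y) :
    0 ≤ (∑ i, ∑ j, ⟪x i, S.dissipation G ⟨star (b i) * b j, hb i j⟩ (x j)⟫_ℂ).re := by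
  set z := ∑ j, b j (x j) with hz
  -- The extra index carries `-|z⟩⟨y|` and `h`; as `⟨y, h⟩ = 1` it contributes `-z`, so the enlarged
  -- family satisfies the constraint.
  let b' : Option ι → H →L[ℂ] H := fun o => o.elim (-rankOne ℂ z y) b
  let x' : Option ι → H := fun o => o.elim h x
  have hbz : ∀ i, star (b i) z = ∑ j, (star (b i) * b j) (x j) := fun i => by
    rw [hz, map_sum]
    rfl
  -- Although `b i` may lie outside the domain algebra, `star (b i) z` stays in `U`: only the
  -- products `bᵢ* bⱼ` act on the `xⱼ`.
  have hbzU : ∀ i, star (b i) z ∈ S.rankOneSubmodule y := fun i => by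
    rw [hbz]
    exact Submodule.sum_mem _ fun j _ => map_mem_rankOneSubmodule (hb i j) (hx j)
  have h00 : star (b' none) * b' none = ((‖z‖ ^ 2 : ℝ) : ℂ) • rankOne ℂ y y := by
    ext w
    simp only [b', Option.elim, ContinuousLinearMap.star_eq_adjoint, map_neg, adjoint_rankOne,
      mul_apply_eq_comp, _root_.neg_apply, rankOne_apply, _root_.smul_apply, neg_neg,
      inner_smul_right, inner_self_eq_norm_sq_to_K, smul_smul]
    push_cast
    rw [mul_comm]
    rfl
  have hi0 : ∀ i, star (b' (some i)) * b' none = -rankOne ℂ (star (b i) z) y := fun i => by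
    simp only [b', Option.elim, mul_neg]
    exact congrArg _ (comp_rankOne _ _ _)
  have h0i : ∀ i, star (b' none) * b' (some i) = star (star (b' (some i)) * b' none) := fun i => by
    rw [star_mul, star_star]
  have hi0D : ∀ i, star (b' (some i)) * b' none ∈ S.domain := fun i => by
    rw [hi0]
    exact neg_mem_domain (mem_domain_of_mem_domainAlgebra (hbzU i))
  have hdom : ∀ i j, star (b' i) * b' j ∈ S.domain := by
    rintro (_ | i) (_ | j)
    · rw [h00]
      exact smul_mem_domain _ hy
    · rw [h0i]
      exact star_mem_domain (hi0D j)
    · exact hi0D i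
    · exact mem_domain_of_mem_domainAlgebra (hb i j)
  have hsum0 : ∑ i, b' i (x' i) = 0 := by
    rw [Fintype.sum_option]
    simp [b', x', hyh, ← hz]
  have hpos := S.re_sum_inner_generator_nonneg b' x' hdom hsum0
  simp only [Fintype.sum_option, Finset.sum_add_distrib, Complex.add_re] at hpos
  have e00 : (⟪x' none, S.generator (star (b' none) * b' none) (x' none)⟫_ℂ).re
      ≤ ‖z‖ ^ 2 * c := by
    rw [h00, generator_smul _ hy, _root_.smul_apply, inner_smul_right, Complex.re_ofReal_mul]
    exact mul_le_mul_of_nonneg_left hc (sq_nonneg _)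
  -- Each cross sum is `-Q - ½ c ‖z‖²`, and the two halves cancel the bound `c ‖z‖²` of `e00`. What
  -- remains is the double sum for the generator minus `2Q`, and `GA`, `AG*` account for one `Q`
  -- each.
  set Q := (∑ i, ⟪x i, G (star (b i) z)⟫_ℂ).re with hQ
  have hxz : (∑ i, ⟪x i, star (b i) z⟫_ℂ).re = ‖z‖ ^ 2 := by
    simp only [ContinuousLinearMap.star_eq_adjoint, ContinuousLinearMap.adjoint_inner_right,
      ← sum_inner, ← hz]
    exact inner_self_eq_norm_sq (𝕜 := ℂ) z
  have ei0 : (∑ i, ⟪x' (some i), S.generator (star (b' (some i)) * b' none) (x' none)⟫_ℂ).re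
      = -Q - 1 / 2 * c * ‖z‖ ^ 2 := by
    have h1 : ∀ i, ⟪x' (some i), S.generator (star (b' (some i)) * b' none) (x' none)⟫_ℂ
        = -⟪x i, G (star (b i) z)⟫_ℂ - ((1 / 2 * c : ℝ) : ℂ) * ⟪x i, star (b i) z⟫_ℂ := fun i => by
      rw [hi0, generator_neg (mem_domain_of_mem_domainAlgebra (hbzU i)), hG _ (hbzU i),
        _root_.neg_apply, inner_neg_right, inner_sub_right, inner_smul_right]
      push_cast
      simp only [x', Option.elim]
      ring
    simp only [h1, Finset.sum_sub_distrib, Finset.sum_neg_distrib, ← Finset.mul_sum, Complex.sub_re,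
      Complex.neg_re, Complex.re_ofReal_mul, hxz, hQ]
  have e0i : (∑ i, ⟪x' none, S.generator (star (b' none) * b' (some i)) (x' (some i))⟫_ℂ).re
      = -Q - 1 / 2 * c * ‖z‖ ^ 2 := by
    rw [← ei0, Complex.re_sum, Complex.re_sum]
    refine Finset.sum_congr rfl fun i _ => ?_
    rw [h0i, generator_star (hi0D i), ContinuousLinearMap.star_eq_adjoint,
      ContinuousLinearMap.adjoint_inner_right]
    exact inner_re_symm (𝕜 := ℂ) _ _
  have hGl : (∑ i, ∑ j, ⟪x i, (G ∘L (star (b i) * b j)) (x j)⟫_ℂ).re = Q := by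
    simp only [hQ, hbz, map_sum, inner_sum]
    rfl
  have hGr : (∑ i, ∑ j, ⟪x i, ((star (b i) * b j) ∘L G.adjoint) (x j)⟫_ℂ).re = Q := by
    rw [← hGl, Finset.sum_comm, Complex.re_sum, Complex.re_sum]
    refine Finset.sum_congr rfl fun j _ => ?_
    rw [Complex.re_sum, Complex.re_sum]
    refine Finset.sum_congr rfl fun i _ => ?_
    have h1 : ⟪x i, ((star (b i) * b j) ∘L G.adjoint) (x j)⟫_ℂ
        = ⟪(G ∘L (star (b j) * b i)) (x i), x j⟫_ℂ := by
      simp only [ContinuousLinearMap.comp_apply, mul_apply_eq_comp,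
        ContinuousLinearMap.star_eq_adjoint, ContinuousLinearMap.adjoint_inner_right]
      rw [← ContinuousLinearMap.adjoint_inner_right G, ContinuousLinearMap.adjoint_inner_left]
    rw [h1]
    exact inner_re_symm (𝕜 := ℂ) _ _
  simp only [dissipation_apply, _root_.sub_apply, inner_sub_right, Finset.sum_sub_distrib,
    Complex.sub_re, hGl, hGr]
  have hLL : (∑ i, ∑ j, ⟪x' (some i), S.generator (star (b' (some i)) * b' (some j))
      (x' (some j))⟫_ℂ).re = (∑ i, ∑ j, ⟪x i, S.generator (star (b i) * b j) (x j)⟫_ℂ).re := rfl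
  rw [hLL, e0i, ei0] at hpos
  linarith

theorem re_sum_inner_dissipation_nonneg_of_dense {y h : H} (hyh : ⟪y, h⟫_ℂ = 1) {c : ℝ}
    (hy : rankOne ℂ y y ∈ S.domain) (hc : (⟪h, S.generator (rankOne ℂ y y) h⟫_ℂ).re ≤ c)
    (hdense : Dense (S.rankOneSpace y)) {G : H →L[ℂ] H} (hG : ∀ x ∈ S.rankOneSpace y,
      G x = S.generator (rankOne ℂ x y) h - ((1 / 2 : ℂ) * c) • x)
    {ι : Type*} [Fintype ι] (b : ι → H →L[ℂ] H) (hb : ∀ i j, star (b i) * b j ∈ S.domainAlgebra)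
    (x : ι → H) :
    0 ≤ (∑ i, ∑ j, ⟪x i, S.dissipation G ⟨star (b i) * b j, hb i j⟩ (x j)⟫_ℂ).re := by
  have hd : Dense (Set.univ.pi fun _ : ι => S.rankOneSpace y) := dense_pi _ fun _ _ => hdense
  refine hd.induction (P := fun x : ι → H =>
    0 ≤ (∑ i, ∑ j, ⟪x i, S.dissipation G ⟨star (b i) * b j, hb i j⟩ (x j)⟫_ℂ).re)
    (fun x hx => re_sum_inner_dissipation_nonneg hyh hy hc hG b hb x fun i => hx i trivial)
    (isClosed_le continuous_const ?_) x
  fun_prop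

/-- Under the bound on the drift, the generator has a minimal Stinespring-type dilation. -/
theorem exists_isMinimalStinespring {y h : H} (hyh : ⟪y, h⟫_ℂ = 1) {c : ℝ}
    (hy : rankOne ℂ y y ∈ S.domain) (hc : (⟪h, S.generator (rankOne ℂ y y) h⟫_ℂ).re ≤ c)
    (hdense : Dense (S.rankOneSpace y)) {G : H →L[ℂ] H} (hG : ∀ x ∈ S.rankOneSpace y,
      G x = S.generator (rankOne ℂ x y) h - ((1 / 2 : ℂ) * c) • x) :
    ∃ (K : Type u) (_ : NormedAddCommGroup K) (_ : InnerProductSpace ℂ K) (_ : CompleteSpace K)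
      (V : H →L[ℂ] K) (π : S.domainAlgebra →⋆ₐ[ℂ] (K →L[ℂ] K)),
      S.IsMinimalStinespring (S.rankOneSpace y) G V π := by
  obtain ⟨K, _, _, _, V, π, hV, hπ, hspan⟩ := exists_stinespring S.domainAlgebra (S.dissipation G)
    (dissipation_star G)
    (fun b hb x => re_sum_inner_dissipation_nonneg_of_dense hyh hy hc hdense hG b hb x)
  refine ⟨K, inferInstance, inferInstance, inferInstance, V, π, ?_, fun A => ?_, ?_⟩
  · exact AddMonoidHomClass.continuous_of_bound π 1 fun A => by simpa using hπ A
  · rw [← hV, dissipation_apply]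
    abel
  · have hle : Submodule.span ℂ {w : K | ∃ a x, w = π a (V x)}
        ≤ (Submodule.span ℂ {w : K | ∃ A : S.domainAlgebra, ∃ x ∈ S.rankOneSpace y,
          w = π A (V x)}).topologicalClosure := by
      rw [Submodule.span_le]
      rintro _ ⟨A, x, rfl⟩
      refine map_mem_closure (f := fun x => π A (V x)) (by fun_prop) (hdense x) fun x hx => ?_
      exact Submodule.subset_span ⟨A, x, hx, rfl⟩
    have h1 := hspan.mono hle
    rw [Submodule.topologicalClosure_coe, dense_closure] at h1
    exact h1

theorem IsMinimalStinespring.isSigmaWeaklyClosable {U : Set H} {K : Type v} [NormedAddCommGroup K]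
    [InnerProductSpace ℂ K] [CompleteSpace K] {G : H →L[ℂ] H} {V : H →L[ℂ] K}
    {π : S.domainAlgebra →⋆ₐ[ℂ] (K →L[ℂ] K)} (hπ : S.IsMinimalStinespring U G V π) :
    IsSigmaWeaklyClosable S.domainAlgebra π := by
  intro l _ B hl hB
  -- This operator is the σ-weak limit of `L(C* A D)`, as the two `G` terms vanish with `C* A D →
  -- 0`; closability of `L` makes it zero.
  have hCD : ∀ C D : S.domainAlgebra, (V.adjoint ∘L π (star C)) ∘L B ∘L (π D ∘L V) = 0 := by
    intro C D
    have h0 : SigmaWeakTendsto (fun A : S.domainAlgebra => ((star C * A * D : S.domainAlgebra) :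
        H →L[ℂ] H)) l 0 := by
      have := hl.sandwich ((star C : S.domainAlgebra) : H →L[ℂ] H) (D : H →L[ℂ] H)
      rw [ContinuousLinearMap.zero_comp, ContinuousLinearMap.comp_zero] at this
      exact this
    refine eq_zero_of_isDerivAtZero (S := S) (fun A : S.domainAlgebra => isDerivAtZero_generator
      (mem_domain_of_mem_domainAlgebra (star C * A * D).2)) h0 ?_
    simp only [hπ.generator_eq]
    have h1 := hB.sandwich (V.adjoint ∘L π (star C)) (π D ∘L V)
    have h2 := h0.sandwich G (ContinuousLinearMap.id ℂ H)
    have h3 := h0.sandwich (ContinuousLinearMap.id ℂ H) G.adjoint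
    have h4 := (h1.add h2).add h3
    simp only [ContinuousLinearMap.zero_comp, ContinuousLinearMap.comp_zero, add_zero] at h4
    refine h4.congr fun A => ?_
    simp only [ContinuousLinearMap.comp_id, ContinuousLinearMap.id_comp, _root_.map_mul]
    rfl
  have hin : ∀ w ∈ {w : K | ∃ A : S.domainAlgebra, ∃ x ∈ U, w = π A (V x)},
      ∀ w' ∈ {w : K | ∃ A : S.domainAlgebra, ∃ x ∈ U, w = π A (V x)}, ⟪w, B w'⟫_ℂ = 0 := by
    rintro _ ⟨C, x, -, rfl⟩ _ ⟨D, z, -, rfl⟩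
    have h1 : ⟪x, ((V.adjoint ∘L π (star C)) ∘L B ∘L (π D ∘L V)) z⟫_ℂ = 0 := by
      rw [hCD, _root_.zero_apply, inner_zero_right]
    rwa [ContinuousLinearMap.comp_apply, ContinuousLinearMap.comp_apply,
      ContinuousLinearMap.adjoint_inner_right, StarHomClass.map_star,
      ContinuousLinearMap.star_eq_adjoint, ContinuousLinearMap.adjoint_inner_right] at h1
  refine ContinuousLinearMap.ext_on hπ.minimal fun w' hw' => ?_
  have h2 : innerSL ℂ (B w') = 0 := ContinuousLinearMap.ext_on hπ.minimal fun w hw => by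
    rw [innerSL_apply_apply, ← inner_conj_symm, hin w hw w' hw']
    simp
  have h3 := DFunLike.congr_fun h2 (B w')
  rw [innerSL_apply_apply] at h3
  simpa using h3

end QuantumMarkovSemigroup

theorem proposition5p4 {H : Type u} [NormedAddCommGroup H] [InnerProductSpace ℂ H]
    [CompleteSpace H] (S : QuantumMarkovSemigroup H)
    (T : H →L[ℂ] H) (hT_pos : T.IsPositive) (hT_fin : FiniteDimensional ℂ T.range)
    (hT_ne : T ≠ 0) (hT_dom : T ∈ S.domain)
    (h : H) (hh : IsAssociateVector T h)
    (hTh : InnerProductSpace.rankOne ℂ (T h) (T h) ∈ S.domain)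
    (hbound : ∃ C : ℝ, 0 < C ∧ ∀ x ∈ S.rankOneSpace (T h),
      ‖S.generator (InnerProductSpace.rankOne ℂ x (T h)) h‖ ≤ C * ‖x‖)
    (hdense : Dense (S.rankOneSpace (T h))) :
    (∃ (K : Type u) (_ : NormedAddCommGroup K) (_ : InnerProductSpace ℂ K) (_ : CompleteSpace K)
      (G : H →L[ℂ] H) (V : H →L[ℂ] K) (π : S.domainAlgebra →⋆ₐ[ℂ] (K →L[ℂ] K)),
      (∀ x ∈ S.rankOneSpace (T h),
        G x = S.generator (InnerProductSpace.rankOne ℂ x (T h)) h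
          - ((1 / 2 : ℂ) * ⟪h, S.generator T h⟫_ℂ) • x) ∧
      S.IsMinimalStinespring (S.rankOneSpace (T h)) G V π) ∧
    (∀ (K : Type v) [NormedAddCommGroup K] [InnerProductSpace ℂ K] [CompleteSpace K]
      (G : H →L[ℂ] H) (V : H →L[ℂ] K) (π : S.domainAlgebra →⋆ₐ[ℂ] (K →L[ℂ] K)),
      S.IsMinimalStinespring (S.rankOneSpace (T h)) G V π →
        IsSigmaWeaklyClosable S.domainAlgebra π) := by
  have hTself : star T = T := hT_pos.isSelfAdjoint.star_eq
  have hin : ⟪h, T h⟫_ℂ = 1 := hh.inner_map_self hT_ne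
  have hyh : ⟪T h, h⟫_ℂ = 1 := by
    rw [← inner_conj_symm, hin, map_one]
  have hLT : star (S.generator T) = S.generator T := by
    rw [← QuantumMarkovSemigroup.generator_star hT_dom, hTself]
  -- `L(T)` is self-adjoint, so the scalar in `G` is real, as the positivity argument requires.
  have hc : ((⟪h, S.generator T h⟫_ℂ).re : ℂ) = ⟪h, S.generator T h⟫_ℂ := by
    rw [← Complex.conj_eq_iff_re, inner_conj_symm]
    nth_rw 1 [← hLT]
    rw [ContinuousLinearMap.star_eq_adjoint, ContinuousLinearMap.adjoint_inner_left]
  refine ⟨?_, fun K _ _ _ G V π hπ => hπ.isSigmaWeaklyClosable⟩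
  obtain ⟨C, -, hC⟩ := hbound
  obtain ⟨G, hG⟩ := QuantumMarkovSemigroup.exists_drift hdense
    ((1 / 2 : ℂ) * ⟪h, S.generator T h⟫_ℂ) hC
  obtain ⟨K, i₁, i₂, i₃, V, π, hπ⟩ := QuantumMarkovSemigroup.exists_isMinimalStinespring hyh hTh
    (QuantumMarkovSemigroup.re_inner_generator_rankOne_le hT_pos hT_dom hin hTh) hdense
    (G := G) (by rwa [hc])
  exact ⟨K, i₁, i₂, i₃, G, V, π, hG, hπ⟩
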